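/- Let $\mathbf B$ be a pointed category (a category with a zero object), and let $(I,G,J)$ be functors $I,J\colon\mathbf A\to\mathbf B$, $G\colon\mathbf B\to\mathbf A$ with $IG=1_{\mathbf B}=JG$. *Definitions.* A cospan $X\xrightarrow{k}Y\xleftarrow{s}Z$ in $\mathbf B$ is an exact patch if $(k,s)$ is jointly epimorphic and there is a (unique) $p\colon Y\to Z$ with $ps=1_Z$, $pk=0$, such that $k$ is a kernel of $p$. A morphism $f\colon A\to GY$ in $\mathbf A$ is organic if $JA\xrightarrow{J(f)}Y\xleftarrow{I(f)}IA$ is an exact patch. A morphism $\alpha\colon E\to A$ is ($I$-)cartesian if for all $g\colon W\to A$ and $h\colon IW\to IE$ with $I(\alpha)h=I(g)$ there is a unique $w\colon W\to E$ with $\alpha w=g$ and $I(w)=h$. A Whitehead sequence is a triple $(A,u,v)$ with $GJA\xrightarrow{v}A\xrightarrow{u}GIA$ such that $I(u)=1_{IA}$, $J(v)=1_{JA}$, $I(v)=J(u)$; a morphism $(A,u,v)\to(A',u',v')$ is an $f\colon A\to A'$ with $fv=v'\,GJ(f)$ and $GI(f)\,u=u'f$. The triple $(I,G,J)$ is an *action-system*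 of $\mathbf A$ over $\mathbf B$ if: 1. $I$ is a fibration, and $J(\alpha)$ is an isomorphism for every cartesian $\alpha$; 2. for every $A$ in $\mathbf A$ there is an organic morphism $\eta_A\colon A\to G(FA)$ which is universal from $A$ to $G$ (so that $F$ is a left adjoint of $G$); 3. (L-condition) whenever $\alpha\colon E\to A$ is cartesian, $f\colon A\to GIE$ is organic, and $\beta\colon A\to E$, $g\colon GJE\to A$ satisfy $I(\beta)=I(f)$, $J(\alpha)=J(g)$, $I(\alpha)J(f)=I(g)J(\beta)$ and $\alpha\beta=1_A$, there is a unique Whitehead sequence $GJE\xrightarrow{g'}E\xrightarrow{f'}GIE$ with $\alpha g'=g$ and $f'\beta=f$. For an action-system put $\iota_A=I(\eta_A)\colon IA\to FA$ and let $\pi_A\colon FA\to IA$ be the unique morphism with $\pi_A\iota_A=1$ and $\pi_AJ(\eta_A)=0$; then $A\mapsto(\pi_A,\iota_A)$ is a functor $R\colon\mathbf A\to\mathsf{Pt}(\mathbf B)$ into the category of split epimorphisms with a chosen section. Every Whitehead sequence $(A,u,v)$ induces, uniquely up to isomorphism, a Whitehead sequence $(A_1,u_1,v_1)$ with $IA_1\cong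 FA$ (regarded as an identification) together with a cartesian $\alpha_1\colon A_1\to A$ and a section $\beta_1$ of $\alpha_1$ such that $GI(\alpha_1)\eta_A=u$, $I(\beta_1)=\iota_A$, $u_1\beta_1=\eta_A$ and $\alpha_1v_1=v\,GJ(\alpha_1)$. Iteration gives its induced sequence $\cdots\to A_2\xrightarrow{\alpha_2}A_1\xrightarrow{\alpha_1}A_0=A$. Let $\mathsf W^{*}(\mathbf A)$ be the full subcategory of the category of Whitehead sequences on those for which, for every $n\ge 1$, the square $\pi_{A_{n-1}}F(\alpha_n)=I(\alpha_n)\pi_{A_n}$ is a pullback. Let $\mathsf{Gpd}(\mathbf B)$ be the category of internal groupoids in $\mathbf B$, regarded as a full subcategory of the category of simplicial objects in $\mathbf B$: those simplicial objects $C$ for which $C_{n+2}$ is, by its two outer faces, the pullback $C_{n+1}\times_{C_n}C_{n+1}$ for all $n\ge0$, and for which every arrow is invertible (there is an inversion morphism $C_1\to C_1$). **Theorem.** Let $(I,G,J)$ be an action-system of $\mathbf A$ over $\mathbf B$. Suppose that $I$ and $J$ are jointly conservative (a morphism $f$ of $\mathbf A$ is an isomorphism whenever $I(f)$ and $J(f)$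 are) and that there is an equivalence of categories $\mathbf A\simeq\mathsf{Pt}(\mathbf B)$ compatible with the system, that is, naturally isomorphic to $R$. Then there is an equivalence of categories $$\mathsf W^{*}(\mathbf A)\simeq\mathsf{Gpd}(\mathbf B).$$ -/

import Mathlib

open CategoryTheory CategoryTheory.Limits

universe v₁ v₂ u₁ u₂

namespace ActionSystems

noncomputable section

/-! ### Patches -/

section Patches

variable {B : Type u₂} [Category.{v₂} B]

/-- The cospan `X ⟶ Y ⟵ Z` is jointly epimorphic. -/
def JointlyEpic {X Y Z : B} (k : X ⟶ Y) (s : Z ⟶ Y) : Prop :=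
  ∀ ⦃W : B⦄ (f g : Y ⟶ W), k ≫ f = k ≫ g → s ≫ f = s ≫ g → f = g

variable [HasZeroMorphisms B]

/-- A (right) patch: a jointly epimorphic cospan `k : X ⟶ Y ⟵ Z : s` for which there is a
(necessarily unique) `p : Y ⟶ Z` with `p s = 1` and `p k = 0`. -/
def IsPatch {X Y Z : B} (k : X ⟶ Y) (s : Z ⟶ Y) : Prop :=
  JointlyEpic k s ∧ ∃ p : Y ⟶ Z, s ≫ p = 𝟙 Z ∧ k ≫ p = 0

/-- An exact patch: a patch in which `k` is a kernel of the retraction `p`. -/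
def IsExactPatch {X Y Z : B} (k : X ⟶ Y) (s : Z ⟶ Y) : Prop :=
  JointlyEpic k s ∧ ∃ p : Y ⟶ Z, s ≫ p = 𝟙 Z ∧
    ∃ w : k ≫ p = 0, Nonempty (IsLimit (KernelFork.ofι k w))

theorem IsExactPatch.isPatch {X Y Z : B} {k : X ⟶ Y} {s : Z ⟶ Y} (h : IsExactPatch k s) :
    IsPatch k s := by
  obtain ⟨h₁, p, h₂, w, -⟩ := h
  exact ⟨h₁, p, h₂, w⟩

end Patches

/-! ### The category of points -/

/-- A point of `B`: a split epimorphism with a chosen section. -/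
structure Pt (B : Type u₂) [Category.{v₂} B] where
  top : B
  base : B
  proj : top ⟶ base
  sec : base ⟶ top
  sec_proj : sec ≫ proj = 𝟙 base

/-- A morphism of points commutes with both the projections and the sections. -/
@[ext]
structure Pt.Hom {B : Type u₂} [Category.{v₂} B] (P Q : Pt B) where
  top : P.top ⟶ Q.top
  base : P.base ⟶ Q.base
  proj_comm : P.proj ≫ base = top ≫ Q.proj
  sec_comm : P.sec ≫ top = base ≫ Q.sec

instance (B : Type u₂) [Category.{v₂} B] : Category (Pt B) where
  Hom := Pt.Hom
  id P := ⟨𝟙 _, 𝟙 _, by simp, by simp⟩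
  comp f g := ⟨f.top ≫ g.top, f.base ≫ g.base,
    by rw [← Category.assoc, f.proj_comm, Category.assoc, g.proj_comm, Category.assoc],
    by rw [← Category.assoc, f.sec_comm, Category.assoc, g.sec_comm, Category.assoc]⟩
  id_comp f := Pt.Hom.ext (Category.id_comp _) (Category.id_comp _)
  comp_id f := Pt.Hom.ext (Category.comp_id _) (Category.comp_id _)
  assoc f g h := Pt.Hom.ext (Category.assoc _ _ _) (Category.assoc _ _ _)

/-! ### Triples of functors and Whitehead sequences -/

/-- An ordered triple of functors `(I, G, J)` with `I, J : A ⥤ B`, `G : B ⥤ A` and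
`I G = 1 = J G`. -/
structure FunctorTriple (A : Type u₁) [Category.{v₁} A] (B : Type u₂) [Category.{v₂} B] where
  I : A ⥤ B
  G : B ⥤ A
  J : A ⥤ B
  G_I : G ⋙ I = 𝟭 B
  G_J : G ⋙ J = 𝟭 B

namespace FunctorTriple

variable {A : Type u₁} [Category.{v₁} A] {B : Type u₂} [Category.{v₂} B] (S : FunctorTriple A B)

/-- The identification `I G Y = Y`. -/
def iG (Y : B) : S.I.obj (S.G.obj Y) ≅ Y := (eqToIso S.G_I).app Y

/-- The identification `J G Y = Y`. -/
def jG (Y : B) : S.J.obj (S.G.obj Y) ≅ Y := (eqToIso S.G_J).app Y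

theorem iG_naturality {Y Z : B} (f : Y ⟶ Z) :
    S.I.map (S.G.map f) ≫ (S.iG Z).hom = (S.iG Y).hom ≫ f :=
  (eqToIso S.G_I).hom.naturality f

theorem jG_naturality {Y Z : B} (f : Y ⟶ Z) :
    S.J.map (S.G.map f) ≫ (S.jG Z).hom = (S.jG Y).hom ≫ f :=
  (eqToIso S.G_J).hom.naturality f

/-- `α` is an `I`-cartesian morphism. -/
def Cartesian {E C : A} (α : E ⟶ C) : Prop :=
  S.I.IsStronglyCartesian (S.I.map α) α

/-- `v : G J C ⟶ C` and `u : C ⟶ G I C` form a Whitehead sequence: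
`I u = 1`, `J v = 1` and `I v = J u`, modulo `I G = 1 = J G`. -/
structure IsWhitehead {C : A} (u : C ⟶ S.G.obj (S.I.obj C)) (v : S.G.obj (S.J.obj C) ⟶ C) :
    Prop where
  I_u : S.I.map u ≫ (S.iG _).hom = 𝟙 (S.I.obj C)
  J_v : (S.jG _).inv ≫ S.J.map v = 𝟙 (S.J.obj C)
  I_v : (S.iG _).inv ≫ S.I.map v = S.J.map u ≫ (S.jG _).hom

/-- `S` is jointly conservative: `I` and `J` jointly reflect isomorphisms. -/
def JointlyConservative : Prop :=
  ∀ ⦃C D : A⦄ (f : C ⟶ D), IsIso (S.I.map f) → IsIso (S.J.map f) → IsIso f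

/-- `f : C ⟶ G Y` is universal from `C` to the functor `G`. -/
def IsUniversalArrow {C : A} {Y : B} (f : C ⟶ S.G.obj Y) : Prop :=
  ∀ ⦃Z : B⦄ (g : C ⟶ S.G.obj Z), ∃! h : Y ⟶ Z, f ≫ S.G.map h = g

variable [HasZeroMorphisms B]

/-- `f : C ⟶ G Y` is organic: the cospan `J C ⟶ Y ⟵ I C` of its components, where `Y = J G Y` and
`Y = I G Y`, is an exact patch. -/
def IsOrganic {C : A} {Y : B} (f : C ⟶ S.G.obj Y) : Prop :=
  IsExactPatch (S.J.map f ≫ (S.jG Y).hom) (S.I.map f ≫ (S.iG Y).hom)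

/-- The L-condition. -/
def LCondition : Prop :=
  ∀ ⦃C E : A⦄ (α : E ⟶ C) (β : C ⟶ E) (g : S.G.obj (S.J.obj E) ⟶ C)
    (f : C ⟶ S.G.obj (S.I.obj E)),
    S.I.map β = S.I.map f ≫ (S.iG _).hom →
    S.J.map α = (S.jG _).inv ≫ S.J.map g →
    S.J.map f ≫ (S.jG _).hom ≫ S.I.map α = S.J.map β ≫ (S.iG _).inv ≫ S.I.map g →
    β ≫ α = 𝟙 C →
    S.Cartesian α →
    S.IsOrganic f →
    ∃! w : (E ⟶ S.G.obj (S.I.obj E)) × (S.G.obj (S.J.obj E) ⟶ E),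
      S.IsWhitehead w.1 w.2 ∧ w.2 ≫ α = g ∧ β ≫ w.1 = f

end FunctorTriple

/-- An action-system `(I, G, J)` of `A` over the pointed category `B`. -/
structure ActionSystem (A : Type u₁) [Category.{v₁} A] (B : Type u₂) [Category.{v₂} B]
    [HasZeroMorphisms B] extends FunctorTriple A B where
  fibered : I.IsFibered
  isIso_J_map : ∀ ⦃E C : A⦄ (α : E ⟶ C), toFunctorTriple.Cartesian α → IsIso (J.map α)
  exists_organic_universal : ∀ C : A, ∃ (Y : B) (f : C ⟶ G.obj Y),
    toFunctorTriple.IsOrganic f ∧ toFunctorTriple.IsUniversalArrow f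
  lCondition : toFunctorTriple.LCondition

/-! ### The left adjoint `F` of `G` and the realization of `A` in the points of `B` -/

namespace ActionSystem

variable {A : Type u₁} [Category.{v₁} A] {B : Type u₂} [Category.{v₂} B] [HasZeroMorphisms B]
  (S : ActionSystem A B)

/-- The object `F C`. -/
def Fobj (C : A) : B := (S.exists_organic_universal C).choose

/-- The universal arrow `C ⟶ G F C`, before `F` is made a functor. -/
def unit (C : A) : C ⟶ S.G.obj (S.Fobj C) := (S.exists_organic_universal C).choose_spec.choose

theorem unit_universal (C : A) : S.IsUniversalArrow (S.unit C) :=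
  (S.exists_organic_universal C).choose_spec.choose_spec.2

/-- The morphism `F C ⟶ Z` that corresponds to `C ⟶ G Z`. -/
def desc {C : A} {Z : B} (g : C ⟶ S.G.obj Z) : S.Fobj C ⟶ Z := (S.unit_universal C g).choose

theorem unit_desc {C : A} {Z : B} (g : C ⟶ S.G.obj Z) :
    S.unit C ≫ S.G.map (S.desc g) = g :=
  (S.unit_universal C g).choose_spec.1

theorem desc_uniq {C : A} {Z : B} (g : C ⟶ S.G.obj Z) (h : S.Fobj C ⟶ Z)
    (w : S.unit C ≫ S.G.map h = g) : h = S.desc g :=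
  (S.unit_universal C g).choose_spec.2 h w

/-- The left adjoint `F` of `G`. -/
def F : A ⥤ B where
  obj := S.Fobj
  map f := S.desc (f ≫ S.unit _)
  map_id C := (S.desc_uniq _ _ (by simp)).symm
  map_comp f g := (S.desc_uniq _ _ (by
    rw [S.G.map_comp, ← Category.assoc, S.unit_desc, Category.assoc, S.unit_desc,
      Category.assoc])).symm

/-- The universal arrow `η : C ⟶ G F C`. -/
def η (C : A) : C ⟶ S.G.obj (S.F.obj C) := S.unit C

theorem η_organic (C : A) : S.IsOrganic (S.η C) :=
  (S.exists_organic_universal C).choose_spec.choose_spec.1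

theorem η_universal (C : A) : S.IsUniversalArrow (S.η C) := S.unit_universal C

theorem η_naturality {C D : A} (f : C ⟶ D) :
    S.η C ≫ S.G.map (S.F.map f) = f ≫ S.η D :=
  S.unit_desc _

/-- The component `J C ⟶ F C` of the universal arrow. -/
def k (C : A) : S.J.obj C ⟶ S.F.obj C := S.J.map (S.η C) ≫ (S.jG _).hom

/-- The component `ι : I C ⟶ F C` of the universal arrow. -/
def ι (C : A) : S.I.obj C ⟶ S.F.obj C := S.I.map (S.η C) ≫ (S.iG _).hom

theorem k_ι_jointlyEpic (C : A) : JointlyEpic (S.k C) (S.ι C) := (S.η_organic C).1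

theorem k_naturality {C D : A} (f : C ⟶ D) : S.k C ≫ S.F.map f = S.J.map f ≫ S.k D := by
  unfold k
  rw [Category.assoc, ← S.jG_naturality, ← Category.assoc, ← S.J.map_comp, S.η_naturality,
    S.J.map_comp, Category.assoc]

theorem ι_naturality {C D : A} (f : C ⟶ D) : S.ι C ≫ S.F.map f = S.I.map f ≫ S.ι D := by
  unfold ι
  rw [Category.assoc, ← S.iG_naturality, ← Category.assoc, ← S.I.map_comp, S.η_naturality,
    S.I.map_comp, Category.assoc]

/-- The morphism `π : F C ⟶ I C`, the unique one with `π ι = 1` and `π k = 0`. -/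
def π (C : A) : S.F.obj C ⟶ S.I.obj C := (S.η_organic C).2.choose

theorem ι_π (C : A) : S.ι C ≫ S.π C = 𝟙 _ := (S.η_organic C).2.choose_spec.1

theorem k_π (C : A) : S.k C ≫ S.π C = 0 := (S.η_organic C).2.choose_spec.2.choose

theorem π_naturality {C D : A} (f : C ⟶ D) : S.F.map f ≫ S.π D = S.π C ≫ S.I.map f := by
  apply S.k_ι_jointlyEpic C
  · rw [← Category.assoc, S.k_naturality, Category.assoc, S.k_π, ← Category.assoc, S.k_π, comp_zero,
      zero_comp]
  · rw [← Category.assoc, S.ι_naturality, Category.assoc, S.ι_π, ← Category.assoc, S.ι_π,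
      Category.comp_id, Category.id_comp]

/-- The realization functor: `C` is sent to the point `F C ⇄ I C` given by `π` and `ι`. -/
def realization : A ⥤ Pt B where
  obj C := ⟨S.F.obj C, S.I.obj C, S.π C, S.ι C, S.ι_π C⟩
  map f := ⟨S.F.map f, S.I.map f, (S.π_naturality f).symm, S.ι_naturality f⟩
  map_id C := Pt.Hom.ext (S.F.map_id C) (S.I.map_id C)
  map_comp f g := Pt.Hom.ext (S.F.map_comp f g) (S.I.map_comp f g)

end ActionSystem

/-! ### The category of Whitehead sequences -/

/-- A Whitehead sequence `G J C ⟶ C ⟶ G I C`. -/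
structure Whitehead {A : Type u₁} [Category.{v₁} A] {B : Type u₂} [Category.{v₂} B]
    (S : FunctorTriple A B) where
  obj : A
  u : obj ⟶ S.G.obj (S.I.obj obj)
  v : S.G.obj (S.J.obj obj) ⟶ obj
  isWhitehead : S.IsWhitehead u v

namespace Whitehead

section

variable {A : Type u₁} [Category.{v₁} A] {B : Type u₂} [Category.{v₂} B] {S : FunctorTriple A B}

/-- A morphism of Whitehead sequences. -/
@[ext]
structure Hom (W W' : Whitehead S) where
  hom : W.obj ⟶ W'.obj
  v_comm : W.v ≫ hom = S.G.map (S.J.map hom) ≫ W'.v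
  u_comm : W.u ≫ S.G.map (S.I.map hom) = hom ≫ W'.u

instance : Category (Whitehead S) where
  Hom := Hom
  id W := ⟨𝟙 _, by simp, by simp⟩
  comp f g := ⟨f.hom ≫ g.hom,
    by rw [← Category.assoc, f.v_comm, Category.assoc, g.v_comm]; simp,
    by rw [S.I.map_comp, S.G.map_comp, ← Category.assoc, f.u_comm, Category.assoc, g.u_comm,
      Category.assoc]⟩
  id_comp f := Hom.ext (Category.id_comp _)
  comp_id f := Hom.ext (Category.comp_id _)
  assoc f g h := Hom.ext (Category.assoc _ _ _)

end

variable {A : Type u₁} [Category.{v₁} A] {B : Type u₂} [Category.{v₂} B] [HasZeroMorphisms B]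
  {S : ActionSystem A B}

/-- The Whitehead sequence `W' = (E, μ, ν)` is induced by `W = (C, u, v)`: there are an
identification `I E ≅ F C` and a cartesian split epimorphism `α : E ⟶ C` with section `β` such that
`G I(α) η = u`, `I(β) = I(η)`, `μ β = η` and `α ν = v G J(α)`.
(Given `W`, such data exist and are unique up to isomorphism.) -/
structure Step (W W' : Whitehead S.toFunctorTriple) where
  α : W'.obj ⟶ W.obj
  β : W.obj ⟶ W'.obj
  θ : S.I.obj W'.obj ≅ S.F.obj W.obj
  cartesian : S.Cartesian α
  β_α : β ≫ α = 𝟙 W.obj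
  η_α : S.η W.obj ≫ S.G.map (θ.inv ≫ S.I.map α) = W.u
  I_β : S.I.map β ≫ θ.hom = S.ι W.obj
  β_u : β ≫ W'.u ≫ S.G.map θ.hom = S.η W.obj
  v_α : W'.v ≫ α = S.G.map (S.J.map α) ≫ W.v

/-- The infinite sequence of cartesian split epimorphisms `⋯ ⟶ C₂ ⟶ C₁ ⟶ C₀` induced by a
Whitehead sequence. It is unique up to isomorphism. -/
structure InducedSequence (W : Whitehead S.toFunctorTriple) where
  seq : ℕ → Whitehead S.toFunctorTriple
  seq_zero : seq 0 = W
  step : ∀ n, Step (seq n) (seq (n + 1))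

/-- The pullback condition that defines `W*(A)`: for every cartesian morphism `α : E ⟶ C` in the
induced sequence, the naturality square of `π : F ⟶ I` at `α` is a pullback. -/
def IsStar : ObjectProperty (Whitehead S.toFunctorTriple) := fun W =>
  ∃ s : InducedSequence W, ∀ n,
    IsPullback (S.π (s.seq (n + 1)).obj) (S.F.map (s.step n).α)
      (S.I.map (s.step n).α) (S.π (s.seq n).obj)

end Whitehead

/-- The category `W*(A)`, a full subcategory of the category `W(A)` of Whitehead sequences. -/
abbrev WStar {A : Type u₁} [Category.{v₁} A] {B : Type u₂} [Category.{v₂} B]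
    [HasZeroMorphisms B] (S : ActionSystem A B) :=
  (Whitehead.IsStar (S := S)).FullSubcategory

/-! ### Internal categories and groupoids -/

section Internal

open Simplicial

variable {B : Type u₂} [Category.{v₂} B]

/-- A simplicial object is an internal category if for all `n` the square of outer faces exhibits
`X_{n+2}` as the pullback `X_{n+1} ×_{X_n} X_{n+1}`; equivalently, `X_n` is the object of strings
of `n` composable arrows of `X_1 ⇉ X_0`. -/
def IsInternalCategory : ObjectProperty (SimplicialObject B) := fun X =>
  ∀ n : ℕ, IsPullback (X.δ (Fin.last (n + 2))) (X.δ (0 : Fin (n + 3)))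
    (X.δ (0 : Fin (n + 2))) (X.δ (Fin.last (n + 1)))

/-- An internal category is an internal groupoid if there is an inversion `i : X_1 ⟶ X_1`. The
morphisms `l, r : X_1 ⟶ X_2` are the composable pairs formed by an arrow followed by its inverse,
respectively by the inverse followed by the arrow; the first face `δ 1` is composition, `δ 1` and
`δ 0` on `X_1` are domain and codomain, and `σ 0` on `X_0` gives the identities. -/
def IsInternalGroupoid : ObjectProperty (SimplicialObject B) := fun X =>
  IsInternalCategory X ∧ ∃ (i : X _⦋1⦌ ⟶ X _⦋1⦌) (l r : X _⦋1⦌ ⟶ X _⦋2⦌),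
    (l ≫ X.δ 2 = 𝟙 _ ∧ l ≫ X.δ 0 = i ∧ l ≫ X.δ 1 = X.δ 1 ≫ X.σ 0) ∧
    (r ≫ X.δ 2 = i ∧ r ≫ X.δ 0 = 𝟙 _ ∧ r ≫ X.δ 1 = X.δ 0 ≫ X.σ 0)

/-- The category of internal groupoids in `B`, a full subcategory of the simplicial objects. -/
abbrev Gpd (B : Type u₂) [Category.{v₂} B] :=
  (IsInternalGroupoid (B := B)).FullSubcategory

end Internal

end

end ActionSystems

/-! Both categories embed fully faithfully into reflexive graphs in `B`, and the two essential
images coincide. A Whitehead sequence `(A, u, v)` goes to the graph `F A ⇉ I A` with source `π`,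
identities `ι` and target the adjoint `hat u` of `u`. A groupoid goes to its arrows and objects. The
arrow `v` is a property and not a structure: `J v` is forced, `I v` is determined by `u`, and a
morphism of `A` is determined by its images under `I` and `J`. For groupoids, composition is
preserved automatically: every split epimorphism is isomorphic to a realized point, so its kernel
and section are jointly epic, and hence so are the two unit sections `f ↦ (1, f)` and `f ↦ (f, 1)`
of the object of composable pairs.

The essential images are compared through a `Tower`, the combinatorial content of an induced
sequence: `X n = I A_n`, `X (n + 1) ≅ F A_n`, and the pullback condition of `W*` makes `X (n + 2)`
the object of composable pairs of `X (n + 1) ⇉ X n`. Joint epicness of the unit sections yields the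
category laws.

From `W*` to groupoids, `v` encodes division `(a, b) ↦ a⁻¹ b` of arrows out of the zero object
(`exists_ker_inv`). Joint conservativity spreads this to all arrows (`hasInverses`): the first
projection of composable pairs, regarded over composition, is inverted by `J` and is therefore
cartesian, and a cartesian lift of the identity picks out inverses. The nerve of a tower with
inverses is then a groupoid (`Tower.exists_groupoid`).

From groupoids to `W*`, the last faces of the simplicial object form a tower with inverses. Its
points are realized in `A`, its pullbacks become cartesian arrows, and division supplies `v`
(`exists_isStar_of_tower`). -/

namespace ActionSystems

noncomputable section

section

/-! ### Towers of multiplicative graphs -/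

/-- A sequence of reflexive graphs `X (n + 1) ⇉ X n`, with projections `p`, `d` and sections `s`,
each of which is the multiplication of the preceding one: `X (n + 2)` is the object of composable
pairs of the graph `X (n + 1) ⇉ X n` (by `p (n + 1)` and `q n`), with composition `d (n + 1)`. -/
structure Tower (B : Type u₂) [Category.{v₂} B] where
  X : ℕ → B
  p : ∀ n, X (n + 1) ⟶ X n
  d : ∀ n, X (n + 1) ⟶ X n
  s : ∀ n, X n ⟶ X (n + 1)
  q : ∀ n, X (n + 2) ⟶ X (n + 1)
  t : ∀ n, X (n + 1) ⟶ X (n + 2)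
  s_p : ∀ n, s n ≫ p n = 𝟙 _
  s_d : ∀ n, s n ≫ d n = 𝟙 _
  isPullback : ∀ n, IsPullback (p (n + 1)) (q n) (d n) (p n)
  t_p : ∀ n, t n ≫ p (n + 1) = p n ≫ s n
  t_q : ∀ n, t n ≫ q n = 𝟙 _
  t_d : ∀ n, t n ≫ d (n + 1) = 𝟙 _
  s_q : ∀ n, s (n + 1) ≫ q n = d n ≫ s n
  jointlyEpic : ∀ n, JointlyEpic (t n) (s (n + 1))

namespace Tower

variable {B : Type u₂} [Category.{v₂} B] (T : Tower B)

attribute [simp] s_p s_d t_q t_d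

@[simp]
theorem s_p_assoc (n : ℕ) {W : B} (f : T.X n ⟶ W) : T.s n ≫ T.p n ≫ f = f := by
  rw [← Category.assoc, s_p, Category.id_comp]

@[simp]
theorem s_d_assoc (n : ℕ) {W : B} (f : T.X n ⟶ W) : T.s n ≫ T.d n ≫ f = f := by
  rw [← Category.assoc, s_d, Category.id_comp]

@[simp]
theorem t_q_assoc (n : ℕ) {W : B} (f : T.X (n + 1) ⟶ W) : T.t n ≫ T.q n ≫ f = f := by
  rw [← Category.assoc, t_q, Category.id_comp]

@[simp]
theorem t_d_assoc (n : ℕ) {W : B} (f : T.X (n + 1) ⟶ W) : T.t n ≫ T.d (n + 1) ≫ f = f := by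
  rw [← Category.assoc, t_d, Category.id_comp]

theorem p_d (n : ℕ) : T.p (n + 1) ≫ T.d n = T.q n ≫ T.p n := (T.isPullback n).w

/-- The source of a composite need only be compared on the pairs `(1, f)` and `(f, 1)`, which are
jointly epic. The same test gives the target in `d_d`, and later associativity. -/
theorem d_p (n : ℕ) : T.d (n + 1) ≫ T.p n = T.p (n + 1) ≫ T.p n := by
  apply T.jointlyEpic n
  · simp [reassoc_of% T.t_p]
  · simp

theorem d_d (n : ℕ) : T.d (n + 1) ≫ T.d n = T.q n ≫ T.d n := by
  apply T.jointlyEpic n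
  · simp
  · simp [reassoc_of% T.s_q]

theorem s_t (n : ℕ) : T.s n ≫ T.t n = T.s n ≫ T.s (n + 1) := by
  apply (T.isPullback n).hom_ext
  · simp [T.t_p]
  · simp [T.s_q]

/-- `h` is the composite of the generalized arrows `f` and `g` of the graph `X 1 ⇉ X 0`. -/
def Comp {W : B} (f g h : W ⟶ T.X 1) : Prop :=
  ∃ x : W ⟶ T.X 2, x ≫ T.p 1 = f ∧ x ≫ T.q 0 = g ∧ x ≫ T.d 1 = h

variable {T}

namespace Comp

variable {W : B} {f g h a b c : W ⟶ T.X 1}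

theorem mid (H : T.Comp f g h) : f ≫ T.d 0 = g ≫ T.p 0 := by
  obtain ⟨x, rfl, rfl, rfl⟩ := H
  simp [T.p_d]

theorem src (H : T.Comp f g h) : h ≫ T.p 0 = f ≫ T.p 0 := by
  obtain ⟨x, rfl, rfl, rfl⟩ := H
  simp [T.d_p]

theorem tgt (H : T.Comp f g h) : h ≫ T.d 0 = g ≫ T.d 0 := by
  obtain ⟨x, rfl, rfl, rfl⟩ := H
  simp [T.d_d]

theorem exists_of (H : f ≫ T.d 0 = g ≫ T.p 0) : ∃ h, T.Comp f g h :=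
  ⟨_, (T.isPullback 0).lift f g H, by simp, by simp, rfl⟩

theorem unique (H : T.Comp f g a) (H' : T.Comp f g b) : a = b := by
  obtain ⟨x, rfl, rfl, rfl⟩ := H
  obtain ⟨y, h₁, h₂, rfl⟩ := H'
  rw [(T.isPullback 0).hom_ext h₁ h₂]

theorem pre {V : B} (w : V ⟶ W) (H : T.Comp f g h) : T.Comp (w ≫ f) (w ≫ g) (w ≫ h) := by
  obtain ⟨x, rfl, rfl, rfl⟩ := H
  exact ⟨w ≫ x, by simp, by simp, by simp⟩

theorem id_left (f : W ⟶ T.X 1) : T.Comp (f ≫ T.p 0 ≫ T.s 0) f f :=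
  ⟨f ≫ T.t 0, by simp [T.t_p], by simp, by simp⟩

theorem id_right (f : W ⟶ T.X 1) : T.Comp f (f ≫ T.d 0 ≫ T.s 0) f :=
  ⟨f ≫ T.s 1, by simp, by simp [T.s_q], by simp⟩

theorem assoc (H₁ : T.Comp f g a) (H₂ : T.Comp g h b) (H₃ : T.Comp a h c) : T.Comp f b c := by
  obtain ⟨x, rfl, rfl, rfl⟩ := H₁
  obtain ⟨y, hy₁, rfl, rfl⟩ := H₂
  obtain ⟨z, hz₁, hz₂, rfl⟩ := H₃
  have e : T.p 2 ≫ T.q 0 ≫ T.d 0 = T.q 1 ≫ T.q 0 ≫ T.p 0 := by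
    rw [← T.d_d, ← T.p_d, reassoc_of% T.p_d]
  -- A generalized element of `X 3` is a pair `((f, g), (fg, h))`, and `n` extracts `(g, h)` from
  -- it.
  let n : T.X 3 ⟶ T.X 2 := (T.isPullback 0).lift (T.p 2 ≫ T.q 0) (T.q 1 ≫ T.q 0) (by simpa using e)
  have np : n ≫ T.p 1 = T.p 2 ≫ T.q 0 := by simp [n]
  have nq : n ≫ T.q 0 = T.q 1 ≫ T.q 0 := by simp [n]
  -- This says that `d 2` sends `((f, g), (fg, h))` to `(f, gh)`. It is tested on the unit sections
  -- `t 1` and `s 2`; associativity then follows from `d_d`.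
  have key : n ≫ T.d 1 = T.d 2 ≫ T.q 0 := by
    have e₀ : T.t 1 ≫ n = T.q 0 ≫ T.t 0 := by
      apply (T.isPullback 0).hom_ext
      · simp only [Category.assoc, np, reassoc_of% T.t_p, T.s_q, T.t_p]
        rw [reassoc_of% (T.p_d 0)]
      · simp [nq]
    have e₁ : T.s 2 ≫ n = T.q 0 ≫ T.s 1 := by
      apply (T.isPullback 0).hom_ext
      · simp [np]
      · simp only [Category.assoc, nq, reassoc_of% T.s_q, T.s_q]
        rw [reassoc_of% (T.d_d 0)]
    apply T.jointlyEpic 1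
    · rw [reassoc_of% e₀]; simp
    · rw [reassoc_of% e₁]; simp
  let w : W ⟶ T.X 3 := (T.isPullback 1).lift x z hz₁.symm
  have wp : w ≫ T.p 2 = x := by simp [w]
  have wq : w ≫ T.q 1 = z := by simp [w]
  have wn : w ≫ n = y := by
    apply (T.isPullback 0).hom_ext
    · rw [Category.assoc, np, reassoc_of% wp, hy₁]
    · rw [Category.assoc, nq, reassoc_of% wq, hz₂]
  refine ⟨w ≫ T.d 2, ?_, ?_, ?_⟩
  · rw [Category.assoc, T.d_p, reassoc_of% wp]
  · rw [Category.assoc, ← key, reassoc_of% wn]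
  · rw [Category.assoc, T.d_d, reassoc_of% wq]

theorem assoc' (H₁ : T.Comp f g a) (H₂ : T.Comp g h b) (H₃ : T.Comp f b c) : T.Comp a h c := by
  obtain ⟨c', hc⟩ := exists_of (H₁.tgt.trans H₂.mid)
  rwa [H₃.unique (H₁.assoc H₂ hc)]

end Comp

variable (T) in
/-- The multiplicative graph `X 1 ⇉ X 0` has right inverses. -/
def HasInverses : Prop := ∃ l : T.X 1 ⟶ T.X 2, l ≫ T.p 1 = 𝟙 _ ∧ l ≫ T.d 1 = T.p 0 ≫ T.s 0

section

variable (hT : T.HasInverses)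

include hT

/-- The monoid argument: if `g` is a right inverse of `f` and `h` one of `g`, then `h = (f g) h = f
(g h) = f`, so `g` is two-sided. -/
theorem HasInverses.exists_inv {W : B} (f : W ⟶ T.X 1) :
    ∃ g, T.Comp f g (f ≫ T.p 0 ≫ T.s 0) ∧ T.Comp g f (f ≫ T.d 0 ≫ T.s 0) := by
  obtain ⟨l, h₁, h₂⟩ := hT
  have key (f : W ⟶ T.X 1) : ∃ g, T.Comp f g (f ≫ T.p 0 ≫ T.s 0) :=
    ⟨f ≫ l ≫ T.q 0, f ≫ l, by simp [h₁], by simp, by simp [h₂]⟩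
  obtain ⟨g, hg⟩ := key f
  obtain ⟨h, hh⟩ := key g
  rw [← Category.assoc, ← hg.mid, Category.assoc] at hh
  refine ⟨g, hg, ?_⟩
  have e : g ≫ T.d 0 = f ≫ T.p 0 := by rw [← hg.tgt]; simp
  have := hg.assoc' hh (Comp.id_right f)
  have e' := this.unique (a := f) (b := h) (by
    have := Comp.id_left h
    rwa [← Category.assoc, ← hh.mid, e, Category.assoc] at this)
  rwa [← e'] at hh

theorem HasInverses.exists_div {W : B} {f f' : W ⟶ T.X 1} (e : f ≫ T.p 0 = f' ≫ T.p 0) :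
    ∃ h, T.Comp f h f' := by
  obtain ⟨g, h₁, h₂⟩ := hT.exists_inv f
  have e' : g ≫ T.d 0 = f' ≫ T.p 0 := by rw [← h₁.tgt]; simpa
  obtain ⟨h, hh⟩ := Comp.exists_of e'
  refine ⟨h, h₁.assoc hh ?_⟩
  rw [← Category.assoc, e, Category.assoc]
  exact Comp.id_left f'

theorem HasInverses.div_unique {W : B} {f f' h h' : W ⟶ T.X 1} (H : T.Comp f h f')
    (H' : T.Comp f h' f') : h = h' := by
  obtain ⟨g, h₁, h₂⟩ := hT.exists_inv f
  have key {h : W ⟶ T.X 1} (H : T.Comp f h f') : T.Comp g f' h :=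
    h₂.assoc H (by rw [← Category.assoc, H.mid, Category.assoc]; exact Comp.id_left h)
  exact (key H).unique (key H')

theorem HasInverses.eq_id_of_idem {W : B} {f : W ⟶ T.X 1} (H : T.Comp f f f) :
    f = f ≫ T.p 0 ≫ T.s 0 := by
  rw [← Category.assoc, ← H.mid, Category.assoc]
  exact hT.div_unique H (Comp.id_right f)

end

/-! ### Cocycles -/

variable (T) in
/-- A functor from the codiscrete groupoid on `ι` to the groupoid of arrows `W ⟶ X 1`. -/
@[ext]
structure Cocycle (ι : Type) (W : B) where
  val : ι → ι → (W ⟶ T.X 1)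
  comp : ∀ i j k, T.Comp (val i j) (val j k) (val i k)

namespace Cocycle

variable {ι κ μ : Type} {W V U : B}

/-- Reindexing. -/
def comap (r : κ → ι) (x : T.Cocycle ι W) : T.Cocycle κ W :=
  ⟨fun i j => x.val (r i) (r j), fun _ _ _ => x.comp _ _ _⟩

/-- Change of the stage of definition. -/
def pre (w : V ⟶ W) (x : T.Cocycle ι W) : T.Cocycle ι V :=
  ⟨fun i j => w ≫ x.val i j, fun _ _ _ => (x.comp _ _ _).pre w⟩

theorem pre_id (x : T.Cocycle ι W) : x.pre (𝟙 W) = x := by ext; simp [pre]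

theorem pre_pre (v : U ⟶ V) (w : V ⟶ W) (x : T.Cocycle ι W) :
    (x.pre w).pre v = x.pre (v ≫ w) := by ext; simp [pre]

theorem comap_comap (r : κ → ι) (r' : μ → κ) (x : T.Cocycle ι W) :
    (x.comap r).comap r' = x.comap (r ∘ r') := rfl

theorem pre_comap (r : κ → ι) (w : V ⟶ W) (x : T.Cocycle ι W) :
    (x.comap r).pre w = (x.pre w).comap r := rfl

variable (hT : T.HasInverses)

include hT

theorem ext_star {x y : T.Cocycle ι W} (c : ι) (h : ∀ i, x.val c i = y.val c i) : x = y := by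
  ext i j
  refine hT.div_unique (x.comp c i j) ?_
  rw [h, h]
  exact y.comp c i j

/-- The cocycle is `g i⁻¹ g j`. With `ext_star`, this reduces questions about cocycles to families
of arrows with a common source. -/
theorem exists_star (g : ι → (W ⟶ T.X 1)) (h : ∀ i j, g i ≫ T.p 0 = g j ≫ T.p 0) :
    ∃ x : T.Cocycle ι W, ∀ i j, T.Comp (g i) (x.val i j) (g j) := by
  choose f hf using fun i j => hT.exists_div (h i j)
  refine ⟨⟨f, fun i j k => ?_⟩, hf⟩
  obtain ⟨c, hc⟩ := Comp.exists_of ((hf i j).tgt.symm.trans (hf j k).mid)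
  rwa [hT.div_unique (hf i k) ((hf i j).assoc hc (hf j k))]

/-- Cocycles glue along a pushout of a span of injections with nonempty vertex. -/
theorem glue {τ : Type} {p : ι → τ} {q : κ → τ} {r : μ → ι} {r' : μ → κ} (c : μ)
    (hp : Function.Injective p) (hq : Function.Injective q)
    (hrange : ∀ t, (∃ i, p i = t) ∨ ∃ i, q i = t)
    (hinter : ∀ i j, p i = q j → ∃ u, r u = i ∧ r' u = j)
    {x : T.Cocycle ι W} {y : T.Cocycle κ W} (h : x.comap r = y.comap r') :
    ∃ z : T.Cocycle τ W, z.comap p = x ∧ z.comap q = y := by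
  have hv (i j) : x.val (r i) (r j) = y.val (r' i) (r' j) :=
    congrFun (congrFun (congrArg Cocycle.val h) i) j
  -- The star of the glued cocycle at the shared vertex `c` is read off from `x` or from `y`; on the
  -- overlap the two readings agree.
  have hg (t : τ) : ∃ g : W ⟶ T.X 1, (∀ i, p i = t → g = x.val (r c) i) ∧
      ∀ i, q i = t → g = y.val (r' c) i := by
    by_cases ht : ∃ i, p i = t
    · obtain ⟨i, rfl⟩ := ht
      refine ⟨x.val (r c) i, fun j hj => by rw [hp hj], fun j hj => ?_⟩
      obtain ⟨u, rfl, rfl⟩ := hinter _ _ hj.symm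
      exact hv _ _
    · obtain ⟨i, rfl⟩ := (hrange t).resolve_left ht
      exact ⟨y.val (r' c) i, fun j hj => (ht ⟨j, hj⟩).elim, fun j hj => by rw [hq hj]⟩
  choose g hg₁ hg₂ using hg
  have hsrc (t : τ) : g t ≫ T.p 0 = x.val (r c) (r c) ≫ T.p 0 := by
    obtain ⟨i, rfl⟩ | ⟨i, rfl⟩ := hrange t
    · rw [hg₁ _ i rfl]
      exact (x.comp (r c) (r c) i).src
    · rw [hg₂ _ i rfl, hv]
      exact (y.comp (r' c) (r' c) i).src
  obtain ⟨z, hz⟩ := exists_star hT g fun i j => (hsrc i).trans (hsrc j).symm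
  refine ⟨z, ?_, ?_⟩
  · ext i j
    have := hz (p i) (p j)
    rw [hg₁ _ i rfl, hg₁ _ j rfl] at this
    exact hT.div_unique this (x.comp _ _ _)
  · ext i j
    have := hz (q i) (q j)
    rw [hg₂ _ i rfl, hg₂ _ j rfl] at this
    exact hT.div_unique this (y.comp _ _ _)

theorem ext_glue {τ : Type} {p : ι → τ} {q : κ → τ} {r : μ → ι} {r' : μ → κ} (c : μ)
    (hpq : ∀ i, p (r i) = q (r' i))
    (hrange : ∀ t, (∃ i, p i = t) ∨ ∃ i, q i = t)
    {x y : T.Cocycle τ W} (h₁ : x.comap p = y.comap p) (h₂ : x.comap q = y.comap q) : x = y := by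
  apply ext_star hT (p (r c))
  intro t
  obtain ⟨i, rfl⟩ | ⟨i, rfl⟩ := hrange t
  · exact congrFun (congrFun (congrArg Cocycle.val h₁) (r c)) i
  · rw [hpq]
    exact congrFun (congrFun (congrArg Cocycle.val h₂) (r' c)) i

section Faces

variable {n : ℕ} {a b : Fin (n + 3)} {a' b' : Fin (n + 2)}

omit hT in
theorem exists_succAbove (hab : a ≠ b) (t : Fin (n + 3)) :
    (∃ i, a.succAbove i = t) ∨ ∃ i, b.succAbove i = t := by
  by_cases h : t = a
  · exact .inr (Fin.exists_succAbove_eq (h ▸ hab))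
  · exact .inl (Fin.exists_succAbove_eq h)

/-- Cocycles on two faces of a simplex that agree on the common face extend to the simplex. -/
theorem glue_faces (hab : a.succAbove b' = b)
    (hc : ∀ i, a.succAbove (b'.succAbove i) = b.succAbove (a'.succAbove i))
    {x y : T.Cocycle (Fin (n + 2)) W} (h : x.comap b'.succAbove = y.comap a'.succAbove) :
    ∃ z : T.Cocycle (Fin (n + 3)) W, z.comap a.succAbove = x ∧ z.comap b.succAbove = y := by
  have hne : a ≠ b := hab ▸ (Fin.succAbove_ne _ _).symm
  refine glue hT (0 : Fin (n + 1)) Fin.succAbove_right_injective Fin.succAbove_right_injective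
    (exists_succAbove hne) (fun i j hij => ?_) h
  have hi : i ≠ b' := by
    rintro rfl
    exact Fin.succAbove_ne b j (hij.symm.trans hab)
  obtain ⟨u, rfl⟩ := Fin.exists_succAbove_eq hi
  exact ⟨u, rfl, Fin.succAbove_right_injective ((hc u).symm.trans hij)⟩

theorem ext_faces (hab : a.succAbove b' = b)
    (hc : ∀ i, a.succAbove (b'.succAbove i) = b.succAbove (a'.succAbove i))
    {x y : T.Cocycle (Fin (n + 3)) W} (h₁ : x.comap a.succAbove = y.comap a.succAbove)
    (h₂ : x.comap b.succAbove = y.comap b.succAbove) : x = y :=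
  ext_glue hT (0 : Fin (n + 1)) hc
    (exists_succAbove (hab ▸ (Fin.succAbove_ne _ _).symm)) h₁ h₂

end Faces

end Cocycle

end Tower

end

/-! ### The nerve of a tower with inverses, represented by cocycles on simplices. -/

section

theorem val_succAbove {n : ℕ} (p : Fin (n + 1)) (i : Fin n) :
    (p.succAbove i : ℕ) = if (i : ℕ) < p then (i : ℕ) else i + 1 := by
  rw [Fin.succAbove]
  simp only [Fin.lt_def, Fin.val_castSucc]
  split_ifs <;> simp

theorem val_predAbove {n : ℕ} (p : Fin n) (i : Fin (n + 1)) :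
    (p.predAbove i : ℕ) = if (p : ℕ) < i then (i : ℕ) - 1 else i := by
  rw [Fin.predAbove]
  simp only [Fin.lt_def, Fin.val_castSucc]
  split_ifs <;> simp

namespace Tower

variable {B : Type u₂} [Category.{v₂} B] {T : Tower B}

/-- Every cocycle arises from `e` by a unique change of the stage of definition. -/
def Cocycle.IsUniversal {ι : Type} {X : B} (e : T.Cocycle ι X) : Prop :=
  ∀ ⦃W : B⦄ (x : T.Cocycle ι W), ∃! f : W ⟶ X, e.pre f = x

variable (T) in
/-- `e` and `e'` exhibit `X n` and `X (n + 1)` as the objects of `n`-simplices and of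
`(n + 1)`-simplices of the nerve, with `p n` and `d n` as the last two faces and `s n` as the last
degeneracy. -/
structure Represents (n : ℕ) (e : T.Cocycle (Fin (n + 1)) (T.X n))
    (e' : T.Cocycle (Fin (n + 2)) (T.X (n + 1))) : Prop where
  univ : e.IsUniversal
  univ' : e'.IsUniversal
  p : e.pre (T.p n) = e'.comap (Fin.last (n + 1)).succAbove
  d : e.pre (T.d n) = e'.comap (Fin.last n).castSucc.succAbove
  s : e'.pre (T.s n) = e.comap (Fin.predAbove (Fin.last n))

variable (hT : T.HasInverses)

include hT

/-- A cocycle on one vertex is an idempotent arrow, hence an identity, hence an object. A cocycle on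
two vertices is its arrow from 0 to 1. -/
theorem exists_represents_zero : ∃ e e', T.Represents 0 e e' := by
  have hidem {W : B} (w : W ⟶ T.X 0) : T.Comp (w ≫ T.s 0) (w ≫ T.s 0) (w ≫ T.s 0) := by
    simpa using Comp.id_left (w ≫ T.s 0)
  let e : T.Cocycle (Fin 1) (T.X 0) := ⟨fun _ _ => T.s 0, fun _ _ _ => by
    simpa using hidem (𝟙 _)⟩
  obtain ⟨e', he'⟩ := Cocycle.exists_star hT
    (fun i : Fin 2 => if i = 0 then T.p 0 ≫ T.s 0 else 𝟙 (T.X 1))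
    (fun i j => by split_ifs <;> simp)
  have h0 (j : Fin 2) : e'.val 0 j = if j = 0 then T.p 0 ≫ T.s 0 else 𝟙 (T.X 1) := by
    have h₁ := he' 0 j
    have h₂ := Comp.id_left (e'.val 0 j)
    rw [if_pos rfl] at h₁
    rw [← Category.assoc, ← h₁.mid] at h₂
    simp only [Category.assoc, T.s_d_assoc] at h₂
    exact h₂.unique h₁
  have h00 : e'.val 0 0 = T.p 0 ≫ T.s 0 := h0 0
  have h01 : e'.val 0 1 = 𝟙 _ := h0 1
  refine ⟨e, e', ?_, ?_, ?_, ?_, ?_⟩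
  · intro W x
    have hx := hT.eq_id_of_idem (x.comp 0 0 0)
    refine ⟨x.val 0 0 ≫ T.p 0, ?_, ?_⟩
    · ext i j
      obtain rfl := Fin.fin_one_eq_zero i
      obtain rfl := Fin.fin_one_eq_zero j
      simpa [Cocycle.pre, e] using hx.symm
    · rintro w rfl
      simp [Cocycle.pre, e]
  · intro W x
    refine ⟨x.val 0 1, ?_, ?_⟩
    · apply Cocycle.ext_star hT 0
      intro i
      fin_cases i
      · have h₁ := hT.eq_id_of_idem (x.comp 0 0 0)
        have h₂ := (x.comp 0 0 1).src
        simp only [Cocycle.pre, Fin.zero_eta, h00]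
        rw [reassoc_of% h₂, ← h₁]
      · simp [Cocycle.pre, h01]
    · rintro w rfl
      simp [Cocycle.pre, h01]
  · ext i j
    obtain rfl := Fin.fin_one_eq_zero i
    obtain rfl := Fin.fin_one_eq_zero j
    exact h00.symm
  · ext i j
    obtain rfl := Fin.fin_one_eq_zero i
    obtain rfl := Fin.fin_one_eq_zero j
    have h₁ := e'.comp 0 1 1
    rw [h01] at h₁
    have h₂ := Comp.id_right (𝟙 (T.X 1))
    rw [Category.id_comp] at h₂
    exact hT.div_unique h₂ h₁
  · apply Cocycle.ext_star hT 0
    intro i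
    fin_cases i
    · simp [Cocycle.pre, Cocycle.comap, h00, e]
    · simp [Cocycle.pre, Cocycle.comap, h01, e]

omit hT in
theorem comap_congr {ι κ : Type} {W : B} (x : T.Cocycle ι W) {r r' : κ → ι} (h : ∀ i, r i = r' i) :
    x.comap r = x.comap r' := by rw [funext h]

/-- The pullback `X (n + 2)` represents pairs of simplices that agree on a common face, and by
gluing these are the simplices one dimension up. In the `(n + 2)`-simplex, `p`, `d` and `q` omit the
vertices `n + 2`, `n + 1` and `n`; the faces `a` and `b` are those of `p` and `q`. -/
theorem Represents.succ {n : ℕ} {e : T.Cocycle (Fin (n + 1)) (T.X n)}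
    {e' : T.Cocycle (Fin (n + 2)) (T.X (n + 1))} (h : T.Represents n e e') :
    ∃ e'', T.Represents (n + 1) e' e'' ∧
      e'.pre (T.q n) = e''.comap (Fin.last n).castSucc.castSucc.succAbove := by
  let a : Fin (n + 3) := Fin.last (n + 2)
  let b : Fin (n + 3) := (Fin.last n).castSucc.castSucc
  let a' : Fin (n + 2) := Fin.last (n + 1)
  let b' : Fin (n + 2) := (Fin.last n).castSucc
  have hab : a.succAbove b' = b := by simp [a, b, b']
  have hc (i : Fin (n + 1)) : a.succAbove (b'.succAbove i) = b.succAbove (a'.succAbove i) := by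
    have := i.2
    simp only [a, b, a', b', Fin.ext_iff, val_succAbove, Fin.val_castSucc, Fin.val_last]
    split_ifs <;> omega
  obtain ⟨e'', hp, hq⟩ := Cocycle.glue_faces hT hab hc
    (x := e'.pre (T.p (n + 1))) (y := e'.pre (T.q n)) (by
      rw [← Cocycle.pre_comap, ← Cocycle.pre_comap, ← h.p, ← h.d, Cocycle.pre_pre,
        Cocycle.pre_pre, T.p_d])
  have hinj {W : B} {f g : W ⟶ T.X (n + 1)} (hfg : e'.pre f = e'.pre g) : f = g :=
    (h.univ' _).unique hfg rfl
  have hs : e''.pre (T.s (n + 1)) = e'.comap (Fin.predAbove (Fin.last (n + 1))) := by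
    apply Cocycle.ext_faces hT hab hc
    · rw [← Cocycle.pre_comap, hp, Cocycle.pre_pre, T.s_p, Cocycle.pre_id, Cocycle.comap_comap]
      refine (comap_congr (r' := id) _ fun i => ?_).symm
      simp [a]
    · rw [← Cocycle.pre_comap, hq, Cocycle.pre_pre, T.s_q, ← Cocycle.pre_pre, h.s,
        Cocycle.pre_comap, h.d, Cocycle.comap_comap, Cocycle.comap_comap]
      refine comap_congr _ fun i => ?_
      have := i.2
      simp only [Function.comp, b, Fin.ext_iff, val_succAbove, val_predAbove, Fin.val_castSucc,
        Fin.val_last]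
      split_ifs <;> omega
  have ht : e''.pre (T.t n) = e'.comap (Fin.predAbove (Fin.last n).castSucc) := by
    apply Cocycle.ext_faces hT hab hc
    · rw [← Cocycle.pre_comap, hp, Cocycle.pre_pre, T.t_p, ← Cocycle.pre_pre, h.s,
        Cocycle.pre_comap, h.p, Cocycle.comap_comap, Cocycle.comap_comap]
      refine comap_congr _ fun i => ?_
      have := i.2
      simp only [Function.comp, a, Fin.ext_iff, val_succAbove, val_predAbove, Fin.val_castSucc,
        Fin.val_last]
      split_ifs <;> omega
    · rw [← Cocycle.pre_comap, hq, Cocycle.pre_pre, T.t_q, Cocycle.pre_id, Cocycle.comap_comap]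
      refine (comap_congr (r' := id) _ fun i => ?_).symm
      have := i.2
      simp only [Function.comp, id, b, Fin.ext_iff, val_succAbove, val_predAbove, Fin.val_castSucc,
        Fin.val_last]
      split_ifs <;> omega
  refine ⟨e'', ⟨h.univ', ?_, hp.symm, ?_, hs⟩, hq.symm⟩
  · intro W x
    obtain ⟨f, hf, -⟩ := h.univ' (x.comap a.succAbove)
    obtain ⟨g, hg, -⟩ := h.univ' (x.comap b.succAbove)
    have w : f ≫ T.d n = g ≫ T.p n := by
      refine (h.univ _).unique ?_ rfl
      rw [← Cocycle.pre_pre, h.d, Cocycle.pre_comap, hf, ← Cocycle.pre_pre, h.p,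
        Cocycle.pre_comap, hg, Cocycle.comap_comap, Cocycle.comap_comap]
      exact comap_congr _ hc
    refine ⟨(T.isPullback n).lift f g w, ?_, ?_⟩
    · apply Cocycle.ext_faces hT hab hc
      · rw [← Cocycle.pre_comap, hp, Cocycle.pre_pre, IsPullback.lift_fst, hf]
      · rw [← Cocycle.pre_comap, hq, Cocycle.pre_pre, IsPullback.lift_snd, hg]
    · rintro y rfl
      apply (T.isPullback n).hom_ext
      · rw [IsPullback.lift_fst]
        apply hinj
        rw [hf, ← Cocycle.pre_pre, ← hp, Cocycle.pre_comap]
      · rw [IsPullback.lift_snd]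
        apply hinj
        rw [hg, ← Cocycle.pre_pre, ← hq, Cocycle.pre_comap]
  -- The remaining face is classified by some `m`, and `m` is the composition `d (n + 1)` because
  -- the two agree on the unit sections.
  · obtain ⟨m, hm, -⟩ := h.univ' (e''.comap (Fin.last (n + 1)).castSucc.succAbove)
    have : m = T.d (n + 1) := by
      apply T.jointlyEpic n
      · apply hinj
        rw [T.t_d, ← Cocycle.pre_pre, hm, Cocycle.pre_comap, ht, Cocycle.pre_id,
          Cocycle.comap_comap]
        refine comap_congr (r' := id) _ fun i => ?_
        have := i.2
        simp only [Function.comp, id, Fin.ext_iff, val_succAbove, val_predAbove, Fin.val_castSucc,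
          Fin.val_last]
        split_ifs <;> omega
      · apply hinj
        rw [T.s_d, ← Cocycle.pre_pre, hm, Cocycle.pre_comap, hs, Cocycle.pre_id,
          Cocycle.comap_comap]
        refine comap_congr (r' := id) _ fun i => ?_
        have := i.2
        simp only [Function.comp, id, Fin.ext_iff, val_succAbove, val_predAbove, Fin.val_castSucc,
          Fin.val_last]
        split_ifs <;> omega
    rw [← this, hm]

theorem exists_represents : ∃ e : ∀ n, T.Cocycle (Fin (n + 1)) (T.X n),
    ∀ n, T.Represents n (e n) (e (n + 1)) ∧
      (e (n + 1)).pre (T.q n) = (e (n + 2)).comap (Fin.last n).castSucc.castSucc.succAbove := by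
  obtain ⟨e₀, e₁, h₀⟩ := exists_represents_zero hT
  let E (n : ℕ) := { x : T.Cocycle (Fin (n + 1)) (T.X n) × T.Cocycle (Fin (n + 2)) (T.X (n + 1)) //
    T.Represents n x.1 x.2 }
  let E' (n : ℕ) : E n := Nat.rec ⟨(e₀, e₁), h₀⟩
    (fun _ x => ⟨(x.1.2, (Represents.succ hT x.2).choose),
      (Represents.succ hT x.2).choose_spec.1⟩) n
  exact ⟨fun n => (E' n).1.1, fun n =>
    ⟨(E' n).2, (Represents.succ hT (E' n).2).choose_spec.2⟩⟩

open Simplicial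

omit hT in
/-- A family of universal cocycles on the simplices makes the `X n` into a simplicial object. -/
theorem exists_simplicialObject (e : ∀ n, T.Cocycle (Fin (n + 1)) (T.X n))
    (he : ∀ n, (e n).IsUniversal) : ∃ (X : SimplicialObject B) (a : ∀ n, X _⦋n⦌ ≅ T.X n),
    ∀ (m n : ℕ) (f : ⦋m⦌ ⟶ ⦋n⦌),
      (e m).pre (X.map f.op ≫ (a m).hom) = ((e n).comap f.toOrderHom).pre (a n).hom := by
  let X : SimplicialObject B :=
    { obj n := T.X n.unop.len
      map f := (he _ ((e _).comap f.unop.toOrderHom)).choose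
      map_id n := (he _ _).unique (he _ _).choose_spec.1 (Cocycle.pre_id _)
      map_comp f g := (he _ _).unique (he _ _).choose_spec.1 (by
        rw [← Cocycle.pre_pre, (he _ _).choose_spec.1, Cocycle.pre_comap, (he _ _).choose_spec.1]
        rfl) }
  refine ⟨X, fun n => Iso.refl (T.X n), fun m n f => ?_⟩
  have h := (he m ((e n).comap f.toOrderHom)).choose_spec.1
  refine Eq.trans (congrArg (fun g => Cocycle.pre g (e m)) (Category.comp_id _)) (h.trans ?_)
  exact (Cocycle.pre_id _).symm

/-- The nerve of a tower with inverses is an internal groupoid. -/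
theorem exists_groupoid : ∃ X : SimplicialObject B, IsInternalGroupoid X ∧
    ∃ (a₁ : X _⦋1⦌ ≅ T.X 1) (a₀ : X _⦋0⦌ ≅ T.X 0),
      X.δ 1 ≫ a₀.hom = a₁.hom ≫ T.p 0 ∧ X.δ 0 ≫ a₀.hom = a₁.hom ≫ T.d 0 ∧
        X.σ 0 ≫ a₁.hom = a₀.hom ≫ T.s 0 := by
  obtain ⟨e, he'⟩ := exists_represents hT
  have he (n : ℕ) := (he' n).1
  have hu (n : ℕ) := (he n).univ
  obtain ⟨X, a, hX⟩ := exists_simplicialObject e hu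
  have hδ {n : ℕ} (i : Fin (n + 2)) : (e n).pre (X.δ i ≫ (a n).hom) =
      ((e (n + 1)).comap i.succAbove).pre (a (n + 1)).hom := hX _ _ (SimplexCategory.δ i)
  have hσ {n : ℕ} (i : Fin (n + 1)) : (e (n + 1)).pre (X.σ i ≫ (a (n + 1)).hom) =
      ((e n).comap i.predAbove).pre (a n).hom := hX _ _ (SimplexCategory.σ i)
  have hinj {n : ℕ} {W : B} {f g : W ⟶ T.X n} (h : (e n).pre f = (e n).pre g) : f = g :=
    (hu n _).unique h rfl
  have hinj' {n : ℕ} {W : B} {f g : W ⟶ X _⦋n⦌}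
      (h : (e n).pre (f ≫ (a n).hom) = (e n).pre (g ≫ (a n).hom)) : f = g :=
    (cancel_mono (a n).hom).1 (hinj h)
  have hface {n : ℕ} (i : Fin (n + 2)) {W : B} (f : W ⟶ X _⦋n + 1⦌) :
      (e n).pre ((f ≫ X.δ i) ≫ (a n).hom) =
        ((e (n + 1)).pre (f ≫ (a (n + 1)).hom)).comap i.succAbove := by
    rw [Category.assoc, ← Cocycle.pre_pre, hδ, Cocycle.pre_pre, Cocycle.pre_comap]
  have hX1 : X.δ (1 : Fin 2) ≫ (a 0).hom = (a 1).hom ≫ T.p 0 := hinj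
    (((hδ 1).trans (congrArg (Cocycle.pre _) (he 0).p.symm)).trans (Cocycle.pre_pre _ _ _))
  have hX0 : X.δ (0 : Fin 2) ≫ (a 0).hom = (a 1).hom ≫ T.d 0 := hinj
    (((hδ 0).trans (congrArg (Cocycle.pre _) (he 0).d.symm)).trans (Cocycle.pre_pre _ _ _))
  have hXs : X.σ (0 : Fin 1) ≫ (a 1).hom = (a 0).hom ≫ T.s 0 := hinj
    (((hσ 0).trans (congrArg (Cocycle.pre _) (he 0).s.symm)).trans (Cocycle.pre_pre _ _ _))
  have hX2 : X.δ (2 : Fin 3) ≫ (a 1).hom = (a 2).hom ≫ T.p 1 := hinj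
    (((hδ 2).trans (congrArg (Cocycle.pre _) (he 1).p.symm)).trans (Cocycle.pre_pre _ _ _))
  have hX21 : X.δ (1 : Fin 3) ≫ (a 1).hom = (a 2).hom ≫ T.d 1 := hinj
    (((hδ 1).trans (congrArg (Cocycle.pre _) (he 1).d.symm)).trans (Cocycle.pre_pre _ _ _))
  have hX20 : X.δ (0 : Fin 3) ≫ (a 1).hom = (a 2).hom ≫ T.q 0 := hinj
    (((hδ 0).trans (congrArg (Cocycle.pre _) (he' 0).2.symm)).trans (Cocycle.pre_pre _ _ _))
  refine ⟨X, ⟨fun n => ?_, ?_⟩, a 1, a 0, hX1, hX0, hXs⟩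
  -- The pullbacks of the tower pair the faces omitting `n + 2` and `n`, whereas an internal
  -- category pairs the two outer faces. Gluing of cocycles covers both.
  · have hab : (Fin.last (n + 2)).succAbove (0 : Fin (n + 2)) = (0 : Fin (n + 3)) := by simp
    have hc (i : Fin (n + 1)) : (Fin.last (n + 2)).succAbove ((0 : Fin (n + 2)).succAbove i) =
        (0 : Fin (n + 3)).succAbove ((Fin.last (n + 1)).succAbove i) := by simp
    have hw : X.δ (Fin.last (n + 2)) ≫ X.δ (0 : Fin (n + 2)) =
        X.δ (0 : Fin (n + 3)) ≫ X.δ (Fin.last (n + 1)) := by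
      apply hinj'
      rw [hface, hface, hδ, hδ, Cocycle.pre_comap, Cocycle.pre_comap, Cocycle.comap_comap,
        Cocycle.comap_comap]
      exact comap_congr _ hc
    have hlift (c : PullbackCone (X.δ (0 : Fin (n + 2))) (X.δ (Fin.last (n + 1)))) :
        ∃ z : T.Cocycle (Fin (n + 3)) c.pt,
          z.comap (Fin.last (n + 2)).succAbove = (e (n + 1)).pre (c.fst ≫ (a (n + 1)).hom) ∧
          z.comap (0 : Fin (n + 3)).succAbove = (e (n + 1)).pre (c.snd ≫ (a (n + 1)).hom) := by
      apply Cocycle.glue_faces hT hab hc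
      rw [← Cocycle.pre_comap, ← Cocycle.pre_comap, ← Cocycle.pre_pre, ← hδ, Cocycle.pre_pre,
        ← Cocycle.pre_pre c.snd, ← hδ, Cocycle.pre_pre, ← Category.assoc, c.condition,
        Category.assoc]
    choose z hz₁ hz₂ using hlift
    choose f hf hf' using fun c => hu (n + 2) (z c)
    refine ⟨⟨hw⟩, ⟨PullbackCone.IsLimit.mk _ (fun c => f c ≫ (a (n + 2)).inv)
      (fun c => ?_) (fun c => ?_) fun c m h₁ h₂ => ?_⟩⟩
    · apply hinj'
      rw [hface, Category.assoc, Iso.inv_hom_id, Category.comp_id, hf, hz₁]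
    · apply hinj'
      rw [hface, Category.assoc, Iso.inv_hom_id, Category.comp_id, hf, hz₂]
    · rw [Iso.eq_comp_inv]
      apply hf'
      apply Cocycle.ext_faces hT hab hc
      · rw [hz₁, ← hface, h₁]
      · rw [hz₂, ← hface, h₂]
  · obtain ⟨i, ⟨l, hl₁, hl₂, hl₃⟩, ⟨r, hr₁, hr₂, hr₃⟩⟩ := hT.exists_inv (𝟙 (T.X 1))
    refine ⟨(a 1).hom ≫ i ≫ (a 1).inv, (a 1).hom ≫ l ≫ (a 2).inv, (a 1).hom ≫ r ≫ (a 2).inv,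
      ⟨?_, ?_, ?_⟩, ⟨?_, ?_, ?_⟩⟩ <;> rw [← cancel_mono (a 1).hom]
    · simp [hX2, hl₁]
    · simp [hX20, hl₂]
    · simp [hX21, hXs, hl₃, reassoc_of% hX1]
    · simp [hX2, hr₁]
    · simp [hX20, hr₂]
    · simp [hX21, hXs, hr₃, reassoc_of% hX0]

end Tower

end

section

/-! ### Reflexive graphs -/

namespace Pt

variable {B : Type u₂} [Category.{v₂} B] {P Q R : Pt B}

theorem hom_ext {f g : P ⟶ Q} (h₁ : f.top = g.top) (h₂ : f.base = g.base) : f = g :=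
  Pt.Hom.ext h₁ h₂

@[simp] theorem id_top : Hom.top (𝟙 P) = 𝟙 P.top := rfl

@[simp] theorem id_base : Hom.base (𝟙 P) = 𝟙 P.base := rfl

@[simp] theorem comp_top (f : P ⟶ Q) (g : Q ⟶ R) : (f ≫ g).top = f.top ≫ g.top := rfl

@[simp] theorem comp_base (f : P ⟶ Q) (g : Q ⟶ R) : (f ≫ g).base = f.base ≫ g.base := rfl

/-- The isomorphism of total objects of isomorphic points. -/
def topIso (e : P ≅ Q) : P.top ≅ Q.top where
  hom := e.hom.top
  inv := e.inv.top
  hom_inv_id := by rw [← comp_top, e.hom_inv_id, id_top]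
  inv_hom_id := by rw [← comp_top, e.inv_hom_id, id_top]

/-- The isomorphism of bases of isomorphic points. -/
def baseIso (e : P ≅ Q) : P.base ≅ Q.base where
  hom := e.hom.base
  inv := e.inv.base
  hom_inv_id := by rw [← comp_base, e.hom_inv_id, id_base]
  inv_hom_id := by rw [← comp_base, e.inv_hom_id, id_base]

end Pt

/-- A reflexive graph: a point together with a second retraction of its section. -/
structure RGraph (B : Type u₂) [Category.{v₂} B] where
  pt : Pt B
  d : pt.top ⟶ pt.base
  sec_d : pt.sec ≫ d = 𝟙 _

namespace RGraph

variable {B : Type u₂} [Category.{v₂} B]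

/-- A morphism of reflexive graphs. -/
@[ext]
structure Hom (X Y : RGraph B) where
  pt : X.pt ⟶ Y.pt
  d_comm : X.d ≫ pt.base = pt.top ≫ Y.d

instance : Category (RGraph B) where
  Hom := Hom
  id X := ⟨𝟙 _, by simp⟩
  comp f g := ⟨f.pt ≫ g.pt, by
    rw [Pt.comp_base, ← Category.assoc, f.d_comm, Category.assoc, g.d_comm, Pt.comp_top,
      Category.assoc]⟩
  id_comp f := Hom.ext (Category.id_comp _)
  comp_id f := Hom.ext (Category.comp_id _)
  assoc f g h := Hom.ext (Category.assoc _ _ _)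

/-- Isomorphic total objects and bases give isomorphic graphs. -/
def isoMk {X Y : RGraph B} (t : X.pt.top ≅ Y.pt.top) (b : X.pt.base ≅ Y.pt.base)
    (hp : X.pt.proj ≫ b.hom = t.hom ≫ Y.pt.proj) (hs : X.pt.sec ≫ t.hom = b.hom ≫ Y.pt.sec)
    (hd : X.d ≫ b.hom = t.hom ≫ Y.d) : X ≅ Y where
  hom := ⟨⟨t.hom, b.hom, hp, hs⟩, hd⟩
  inv := ⟨⟨t.inv, b.inv, by rw [Iso.comp_inv_eq, Category.assoc, hp, Iso.inv_hom_id_assoc],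
    by rw [Iso.comp_inv_eq, Category.assoc, hs, Iso.inv_hom_id_assoc]⟩,
    by
      change Y.d ≫ b.inv = t.inv ≫ X.d
      rw [Iso.comp_inv_eq, Category.assoc, hd, Iso.inv_hom_id_assoc]⟩
  hom_inv_id := Hom.ext (Pt.hom_ext t.hom_inv_id b.hom_inv_id)
  inv_hom_id := Hom.ext (Pt.hom_ext t.inv_hom_id b.inv_hom_id)

end RGraph

/-! ### Action-systems and their realization -/

namespace ActionSystem

variable {A : Type u₁} [Category.{v₁} A] {B : Type u₂} [Category.{v₂} B] [HasZeroMorphisms B]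
  (S : ActionSystem A B)

/-- The morphism `F C ⟶ Z` adjoint to `C ⟶ G Z`. -/
def hat {C : A} {Z : B} (g : C ⟶ S.G.obj Z) : S.F.obj C ⟶ Z := S.desc g

variable {S}

theorem η_hat {C : A} {Z : B} (g : C ⟶ S.G.obj Z) : S.η C ≫ S.G.map (S.hat g) = g := S.unit_desc g

theorem eq_hat {C : A} {Z : B} {g : C ⟶ S.G.obj Z} {h : S.F.obj C ⟶ Z}
    (w : S.η C ≫ S.G.map h = g) : h = S.hat g := S.desc_uniq g h w

theorem hat_injective {C : A} {Z : B} {f g : C ⟶ S.G.obj Z} (h : S.hat f = S.hat g) : f = g := by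
  rw [← η_hat f, h, η_hat]

theorem hat_comp {C D : A} {Z : B} (f : C ⟶ D) (g : D ⟶ S.G.obj Z) :
    S.hat (f ≫ g) = S.F.map f ≫ S.hat g := by
  refine (eq_hat ?_).symm
  rw [S.G.map_comp, ← Category.assoc, S.η_naturality, Category.assoc, η_hat]

theorem hat_comp_map {C : A} {Y Z : B} (g : C ⟶ S.G.obj Y) (h : Y ⟶ Z) :
    S.hat (g ≫ S.G.map h) = S.hat g ≫ h := by
  refine (eq_hat ?_).symm
  rw [S.G.map_comp, ← Category.assoc, η_hat]

theorem ι_hat {C : A} {Z : B} (g : C ⟶ S.G.obj Z) :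
    S.ι C ≫ S.hat g = S.I.map g ≫ (S.iG Z).hom := by
  unfold ι
  rw [Category.assoc, ← S.iG_naturality, ← Category.assoc, ← S.I.map_comp, η_hat]

theorem k_hat {C : A} {Z : B} (g : C ⟶ S.G.obj Z) :
    S.k C ≫ S.hat g = S.J.map g ≫ (S.jG Z).hom := by
  unfold k
  rw [Category.assoc, ← S.jG_naturality, ← Category.assoc, ← S.J.map_comp, η_hat]

instance (C : A) : Mono (S.k C) := by
  obtain ⟨w, ⟨h⟩⟩ := (S.η_organic C).2.choose_spec.2
  exact ⟨fun f g e => Fork.IsLimit.hom_ext h e⟩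

theorem exists_kernel_lift {C : A} {W : B} (x : W ⟶ S.F.obj C) (hx : x ≫ S.π C = 0) :
    ∃ y, y ≫ S.k C = x := by
  obtain ⟨w, ⟨h⟩⟩ := (S.η_organic C).2.choose_spec.2
  exact ⟨_, (KernelFork.IsLimit.lift' h x hx).2⟩

theorem cartesian_lift {C E : A} {α : E ⟶ C} (hα : S.Cartesian α) {W : A} (g : W ⟶ C)
    (h : S.I.obj W ⟶ S.I.obj E) (w : h ≫ S.I.map α = S.I.map g) :
    ∃ x : W ⟶ E, x ≫ α = g ∧ S.I.map x = h := by
  have : S.I.IsHomLift (h ≫ S.I.map α) g := w ▸ inferInstance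
  obtain ⟨x, ⟨h₁, h₂⟩, -⟩ := hα.universal_property' h g
  exact ⟨x, h₂, (IsHomLift.eq_of_isHomLift _ h x).symm⟩

theorem exists_cartesian {C : A} {R : B} (f : R ⟶ S.I.obj C) :
    ∃ (E : A) (χ : E ⟶ C) (e : R ≅ S.I.obj E), e.hom ≫ S.I.map χ = f ∧ S.Cartesian χ := by
  have := S.fibered
  obtain ⟨E, χ, h⟩ := Functor.IsPreFibered.exists_isCartesian' f
  obtain rfl : S.I.obj E = R := IsHomLift.domain_eq S.I f χ
  obtain rfl := IsHomLift.eq_of_isHomLift S.I f χ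
  exact ⟨E, χ, Iso.refl _, Category.id_comp _,
    Functor.IsFibered.isStronglyCartesian_of_isCartesian S.I (S.I.map χ) χ⟩

/-- A morphism that `J` inverts is cartesian when `I` and `J` are jointly conservative. -/
theorem cartesian_of_isIso_J (hS : S.JointlyConservative) {D C : A} (φ : D ⟶ C)
    [IsIso (S.J.map φ)] : S.Cartesian φ := by
  obtain ⟨E, χ, e, he, hχ⟩ := exists_cartesian (S.I.map φ)
  obtain ⟨x, hx, hI⟩ := cartesian_lift hχ φ e.hom he
  have := S.isIso_J_map χ hχ
  have hJ : IsIso (S.J.map x) := by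
    have : IsIso (S.J.map x ≫ S.J.map χ) := by rw [← S.J.map_comp, hx]; infer_instance
    -- `J χ` is invertible since `χ` is cartesian, so `J` inverts the comparison `x` of `φ` with the
    -- cartesian lift `χ`; `I x` is invertible by construction.
    exact IsIso.of_isIso_comp_right _ (S.J.map χ)
  have := hS x (hI ▸ inferInstance) hJ
  have := hχ.toIsHomLift
  refine { universal_property' := fun {W} g ψ _ => ?_ }
  have hg : g ≫ S.I.map φ = S.I.map ψ := IsHomLift.eq_of_isHomLift S.I _ ψ
  have : S.I.IsHomLift ((g ≫ S.I.map x) ≫ S.I.map χ) ψ := by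
    rw [Category.assoc, ← S.I.map_comp, hx, hg]; infer_instance
  obtain ⟨y, ⟨h₁, h₂⟩, h₃⟩ := hχ.universal_property' (g ≫ S.I.map x) ψ
  have hy : g ≫ S.I.map x = S.I.map y := IsHomLift.eq_of_isHomLift S.I _ y
  refine ⟨y ≫ inv x, ⟨?_, ?_⟩, ?_⟩
  · have : g = S.I.map (y ≫ inv x) := by
      rw [S.I.map_comp, ← hy, Category.assoc, ← S.I.map_comp]; simp
    rw [this]; infer_instance
  · rw [← hx, Category.assoc, IsIso.inv_hom_id_assoc, h₂]
  · rintro z ⟨hz, hz'⟩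
    rw [IsIso.eq_comp_inv]
    refine h₃ _ ⟨inferInstance, ?_⟩
    rw [Category.assoc, hx, hz']

/-- The first projection of the point `G Y`. -/
def fst (Y : B) : S.F.obj (S.G.obj Y) ⟶ Y := S.π _ ≫ (S.iG Y).hom

/-- The counit of `F ⊣ G`, as the second projection of the point `G Y`. -/
def snd (Y : B) : S.F.obj (S.G.obj Y) ⟶ Y := S.hat (𝟙 _)

theorem k_fst (Y : B) : S.k (S.G.obj Y) ≫ fst Y = 0 := by
  rw [fst, ← Category.assoc, k_π, zero_comp]

theorem ι_fst (Y : B) : S.ι (S.G.obj Y) ≫ fst Y = (S.iG Y).hom := by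
  rw [fst, ← Category.assoc, ι_π, Category.id_comp]

theorem k_snd (Y : B) : S.k (S.G.obj Y) ≫ snd Y = (S.jG Y).hom := by
  rw [snd, k_hat, S.J.map_id, Category.id_comp]

theorem ι_snd (Y : B) : S.ι (S.G.obj Y) ≫ snd Y = (S.iG Y).hom := by
  rw [snd, ι_hat, S.I.map_id, Category.id_comp]

section Faithful

variable [S.realization.Faithful]

theorem hom_ext_F_I {C D : A} {f g : C ⟶ D} (hF : S.F.map f = S.F.map g)
    (hI : S.I.map f = S.I.map g) : f = g :=
  S.realization.map_injective (Pt.hom_ext hF hI)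

theorem hom_ext_J_I {C D : A} {f g : C ⟶ D} (hJ : S.J.map f = S.J.map g)
    (hI : S.I.map f = S.I.map g) : f = g := by
  refine hom_ext_F_I (S.k_ι_jointlyEpic C _ _ ?_ ?_) hI
  · rw [k_naturality, k_naturality, hJ]
  · rw [ι_naturality, ι_naturality, hI]

end Faithful

section Full

variable [S.realization.Full]

theorem exists_hom {C D : A} (t : S.F.obj C ⟶ S.F.obj D) (b : S.I.obj C ⟶ S.I.obj D)
    (hπ : S.π C ≫ b = t ≫ S.π D) (hι : S.ι C ≫ t = b ≫ S.ι D) :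
    ∃ f : C ⟶ D, S.F.map f = t ∧ S.I.map f = b := by
  let φ : S.realization.obj C ⟶ S.realization.obj D := ⟨t, b, hπ, hι⟩
  exact ⟨S.realization.preimage φ, congrArg Pt.Hom.top (S.realization.map_preimage φ),
    congrArg Pt.Hom.base (S.realization.map_preimage φ)⟩

/-- Under the realization `I` is the functor sending a point to its base, whose cartesian arrows
include the pullback squares. -/
theorem cartesian_of_isPullback [S.realization.Faithful] {E C : A} (α : E ⟶ C)
    (h : IsPullback (S.π E) (S.F.map α) (S.I.map α) (S.π C)) : S.Cartesian α := by
  refine { universal_property' := fun {W} g ψ _ => ?_ }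
  have hg : g ≫ S.I.map α = S.I.map ψ := IsHomLift.eq_of_isHomLift S.I _ ψ
  have hw : (S.π W ≫ g) ≫ S.I.map α = S.F.map ψ ≫ S.π C := by
    rw [Category.assoc, hg, S.π_naturality]
  obtain ⟨x, hF, hI⟩ := exists_hom (h.lift _ _ hw) g (by simp) (by
    apply h.hom_ext
    · simp [reassoc_of% (S.ι_π W), S.ι_π E]
    · rw [Category.assoc, h.lift_snd, Category.assoc, S.ι_naturality, S.ι_naturality, ← hg,
        Category.assoc])
  refine ⟨x, ⟨hI ▸ inferInstance, hom_ext_F_I (S := S) ?_ ?_⟩, ?_⟩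
  · rw [S.F.map_comp, hF, h.lift_snd]
  · rw [S.I.map_comp, hI, hg]
  · rintro y ⟨hy, rfl⟩
    have hy' : g = S.I.map y := IsHomLift.eq_of_isHomLift S.I g y
    refine hom_ext_F_I (S := S) (h.hom_ext ?_ ?_) (hy'.symm.trans hI.symm)
    · rw [S.π_naturality, S.π_naturality, hI, ← hy']
    · rw [hF, h.lift_snd, S.F.map_comp]

end Full

theorem exists_iso_point [S.realization.EssSurj] {X Z : B} (p : X ⟶ Z) (s : Z ⟶ X)
    (h : s ≫ p = 𝟙 Z) :
    ∃ (C : A) (t : S.F.obj C ≅ X) (b : S.I.obj C ≅ Z),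
      S.π C ≫ b.hom = t.hom ≫ p ∧ S.ι C ≫ t.hom = b.hom ≫ s := by
  let e := S.realization.objObjPreimageIso ⟨X, Z, p, s, h⟩
  exact ⟨_, Pt.topIso e, Pt.baseIso e, e.hom.proj_comm, e.hom.sec_comm⟩

/-- The two projections of the point `G Y` are exchanged by an involution. -/
theorem exists_twist [S.realization.IsEquivalence] (Y : B) :
    ∃ τ : S.F.obj (S.G.obj Y) ⟶ S.F.obj (S.G.obj Y), τ ≫ fst Y = snd Y ∧ τ ≫ snd Y = fst Y ∧
      S.ι _ ≫ τ = S.ι _ ∧ τ ≫ τ = 𝟙 _ := by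
  -- `D` is `F G Y` regarded as a point by its second projection; the adjoint of the first
  -- projection maps it to `G Y`, and this map induces `τ`.
  obtain ⟨D, t, b, hπ, hι⟩ := exists_iso_point (S := S) (snd Y) ((S.iG Y).inv ≫ S.ι _)
    (by rw [Category.assoc, ι_snd, Iso.inv_hom_id])
  let g : D ⟶ S.G.obj Y := S.η D ≫ S.G.map (t.hom ≫ fst Y)
  have hg : S.hat g = t.hom ≫ fst Y := (eq_hat rfl).symm
  have hgF : S.F.map g ≫ snd Y = t.hom ≫ fst Y := by
    rw [← hg, snd, ← hat_comp, Category.comp_id]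
  have hgI : S.I.map g ≫ (S.iG Y).hom = b.hom := by
    rw [← ι_hat, hg, ← Category.assoc, hι]
    simp [ι_fst]
  have h₁ : (t.inv ≫ S.F.map g) ≫ fst Y = snd Y := by
    rw [Category.assoc, Iso.inv_comp_eq, fst, ← Category.assoc, S.π_naturality, Category.assoc, hgI]
    exact hπ
  have h₂ : (t.inv ≫ S.F.map g) ≫ snd Y = fst Y := by
    rw [Category.assoc, hgF, Iso.inv_hom_id_assoc]
  have h₃ : S.ι _ ≫ t.inv ≫ S.F.map g = S.ι _ := by
    have : S.ι (S.G.obj Y) ≫ t.inv = (S.iG Y).hom ≫ b.inv ≫ S.ι D := by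
      rw [Iso.comp_inv_eq, Category.assoc, Category.assoc, hι]
      simp
    rw [reassoc_of% this, S.ι_naturality, ← cancel_epi (S.iG Y).inv, Iso.inv_hom_id_assoc,
      Iso.inv_comp_eq, ← hgI, Category.assoc, Iso.hom_inv_id_assoc]
  generalize t.inv ≫ S.F.map g = τ at h₁ h₂ h₃
  refine ⟨τ, h₁, h₂, h₃, ?_⟩
  have hπ : τ ≫ τ ≫ S.π _ = S.π _ := by
    rw [← cancel_mono (S.iG Y).hom]
    simpa only [Category.assoc, fst, h₂] using (congrArg (τ ≫ ·) h₁).trans h₂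
  -- Since `τ ≫ τ` preserves `π` and `ι`, it comes from an endomorphism `a` of `G Y`. As it also
  -- preserves `snd`, the counit, the adjunction gives `a = 𝟙`.
  obtain ⟨a, ha, ha'⟩ := exists_hom (τ ≫ τ) (𝟙 _) (by simp [hπ]) (by
    rw [← Category.assoc, h₃, h₃, Category.id_comp])
  have : a = 𝟙 _ := by
    apply hat_injective
    rw [← Category.comp_id a, hat_comp, ha, ← snd, Category.assoc, h₂, h₁]
  rw [← ha, this, S.F.map_id]

end ActionSystem

/-! ### Whitehead sequences as reflexive graphs -/

namespace Whitehead

open ActionSystem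

variable {A : Type u₁} [Category.{v₁} A] {B : Type u₂} [Category.{v₂} B] [HasZeroMorphisms B]
  {S : ActionSystem A B}

theorem ι_hat_u (W : Whitehead S.toFunctorTriple) : S.ι W.obj ≫ S.hat W.u = 𝟙 _ := by
  rw [ι_hat, W.isWhitehead.I_u]

theorem J_v (W : Whitehead S.toFunctorTriple) : S.J.map W.v = (S.jG _).hom := by
  rw [← cancel_epi (S.jG _).inv, W.isWhitehead.J_v, Iso.inv_hom_id]

theorem I_v (W : Whitehead S.toFunctorTriple) :
    S.I.map W.v = (S.iG _).hom ≫ S.k W.obj ≫ S.hat W.u := by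
  rw [k_hat, ← W.isWhitehead.I_v, Iso.hom_inv_id_assoc]

/-- Compatibility with `v` is automatic: it may be tested after `J`, where `v` is the canonical
identification, and after `I`, where `v` is expressed by `u`. -/
theorem v_comm_of_hat [S.realization.Faithful] {W W' : Whitehead S.toFunctorTriple}
    (f : W.obj ⟶ W'.obj) (h : S.hat W.u ≫ S.I.map f = S.F.map f ≫ S.hat W'.u) :
    W.v ≫ f = S.G.map (S.J.map f) ≫ W'.v := by
  apply hom_ext_J_I (S := S)
  · rw [S.J.map_comp, S.J.map_comp, J_v, J_v, S.jG_naturality]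
  · rw [S.I.map_comp, S.I.map_comp, I_v, I_v, ← Category.assoc _ (S.iG _).hom, S.iG_naturality,
      Category.assoc, Category.assoc, h, ← Category.assoc (S.k _), S.k_naturality, Category.assoc,
      Category.assoc]

variable (S) in
/-- The reflexive graph of a Whitehead sequence. -/
def toRGraph : Whitehead S.toFunctorTriple ⥤ RGraph B where
  obj W := ⟨S.realization.obj W.obj, S.hat W.u, W.ι_hat_u⟩
  map f := ⟨S.realization.map f.hom, by
    change S.hat _ ≫ S.I.map f.hom = S.F.map f.hom ≫ S.hat _
    rw [← hat_comp_map, f.u_comm, hat_comp]⟩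
  map_id W := RGraph.Hom.ext (S.realization.map_id _)
  map_comp f g := RGraph.Hom.ext (S.realization.map_comp _ _)

instance [S.realization.Faithful] : (toRGraph S).Faithful where
  map_injective h := Hom.ext (S.realization.map_injective (congrArg RGraph.Hom.pt h))

instance [S.realization.Faithful] [S.realization.Full] : (toRGraph S).Full where
  map_surjective {W W'} φ := by
    obtain ⟨f, hf⟩ := S.realization.map_surjective φ.pt
    have h : S.hat W.u ≫ S.I.map f = S.F.map f ≫ S.hat W'.u := by
      have := φ.d_comm
      rw [← hf] at this
      exact this
    refine ⟨⟨f, v_comm_of_hat f h, hat_injective ?_⟩, RGraph.Hom.ext hf⟩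
    rw [hat_comp_map, h, hat_comp]

end Whitehead

end

/-! ### From Whitehead sequences in `W*` to internal groupoids. -/

section

namespace Whitehead

open ActionSystem

variable {A : Type u₁} [Category.{v₁} A] {B : Type u₂} [Category.{v₂} B] [HasZeroMorphisms B]
  {S : ActionSystem A B}

theorem Step.I_α {W W' : Whitehead S.toFunctorTriple} (x : Step W W') :
    S.I.map x.α = x.θ.hom ≫ S.hat W.u := by
  rw [← Iso.inv_comp_eq]
  exact eq_hat x.η_α

theorem Step.F_β_hat {W W' : Whitehead S.toFunctorTriple} (x : Step W W') :
    S.F.map x.β ≫ S.hat W'.u = x.θ.inv := by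
  rw [← hat_comp, ← cancel_mono x.θ.hom, ← hat_comp_map, Category.assoc, x.β_u, Iso.inv_hom_id]
  exact (eq_hat (by rw [S.G.map_id, Category.comp_id])).symm

theorem Step.β_α_map {W W' : Whitehead S.toFunctorTriple} (x : Step W W') {D : Type*} [Category D]
    (H : A ⥤ D) : H.map x.β ≫ H.map x.α = 𝟙 _ := by
  rw [← H.map_comp, x.β_α, H.map_id]

theorem Step.J_α_β {W W' : Whitehead S.toFunctorTriple} (x : Step W W') :
    S.J.map x.α ≫ S.J.map x.β = 𝟙 _ := by
  have := S.isIso_J_map _ x.cartesian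
  rw [← cancel_mono (S.J.map x.α), Category.assoc, x.β_α_map, Category.comp_id, Category.id_comp]

/-- The tower of graphs underlying a sequence of induced Whitehead sequences. -/
def tower (W : ℕ → Whitehead S.toFunctorTriple) (x : ∀ n, Step (W n) (W (n + 1)))
    (h : ∀ n, IsPullback (S.π (W (n + 1)).obj) (S.F.map (x n).α) (S.I.map (x n).α)
      (S.π (W n).obj)) : Tower B where
  X n := S.I.obj (W n).obj
  p n := (x n).θ.hom ≫ S.π _
  d n := S.I.map (x n).α
  s n := S.I.map (x n).β
  q n := (x (n + 1)).θ.hom ≫ S.F.map (x n).α ≫ (x n).θ.inv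
  t n := (x n).θ.hom ≫ S.F.map (x n).β ≫ (x (n + 1)).θ.inv
  s_p n := by rw [← Category.assoc, (x n).I_β, S.ι_π]
  s_d n := (x n).β_α_map _
  isPullback n := IsPullback.of_iso (h n) (x (n + 1)).θ.symm (Iso.refl _) (x n).θ.symm (Iso.refl _)
    (by simp) (by simp) (by simp) (by simp)
  t_p n := by
    simp [S.π_naturality]
  t_q n := by
    simp [reassoc_of% ((x n).β_α_map S.F)]
  t_d n := by
    rw [(x (n + 1)).I_α]
    simp [(x n).F_β_hat]
  s_q n := by
    rw [reassoc_of% ((x (n + 1)).I_β), reassoc_of% (S.ι_naturality (x n).α), ← (x n).I_β]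
    simp
  jointlyEpic n := by
    intro Z f g h₁ h₂
    rw [← cancel_epi (x (n + 1)).θ.inv]
    apply S.k_ι_jointlyEpic
    -- Since `J α` is invertible with inverse `J β`, the kernel inclusion factors through `F β`,
    -- that is, through the unit section `t n`.
    · have e : S.k (W (n + 1)).obj = S.J.map (x n).α ≫ S.k _ ≫ S.F.map (x n).β := by
        rw [S.k_naturality, ← Category.assoc, (x n).J_α_β, Category.id_comp]
      simp only [Category.assoc, Iso.cancel_iso_hom_left] at h₁
      simp only [e, Category.assoc, h₁]
    · rw [← (x (n + 1)).I_β]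
      simpa using h₂

section

variable {T : Tower B} {W : Whitehead S.toFunctorTriple} (θ : T.X 1 ≅ S.F.obj W.obj)
  (e : T.X 0 ≅ S.I.obj W.obj)

/-- Inversion of generalized elements of the kernel of the projection, induced by `v`. -/
theorem exists_ker_inv [S.realization.IsEquivalence] (hp : T.p 0 ≫ e.hom = θ.hom ≫ S.π W.obj)
    (hd : T.d 0 ≫ e.hom = θ.hom ≫ S.hat W.u) (hs : T.s 0 ≫ θ.hom = e.hom ≫ S.ι W.obj) :
    ∃ w : S.J.obj W.obj ⟶ T.X 1, T.Comp (S.k _ ≫ θ.inv) w 0 ∧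
      T.Comp w (S.k _ ≫ θ.inv) ((S.k _ ≫ θ.inv) ≫ T.d 0 ≫ T.s 0) := by
  have hKp : (S.k W.obj ≫ θ.inv) ≫ T.p 0 = 0 := by
    rw [← cancel_mono e.hom, Category.assoc, Category.assoc, hp, Iso.inv_hom_id_assoc, k_π,
      zero_comp]
  have hKd : (S.k W.obj ≫ θ.inv) ≫ T.d 0 ≫ e.hom = S.k _ ≫ S.hat W.u := by
    rw [Category.assoc, hd, Iso.inv_hom_id_assoc]
  have hkV : S.k _ ≫ S.F.map W.v ≫ θ.inv = (S.jG _).hom ≫ S.k _ ≫ θ.inv := by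
    rw [← Category.assoc, S.k_naturality, J_v, Category.assoc]
  have hιV : S.ι _ ≫ S.F.map W.v ≫ θ.inv =
      (S.iG _).hom ≫ (S.k _ ≫ θ.inv) ≫ T.d 0 ≫ T.s 0 := by
    rw [← cancel_mono θ.hom, Category.assoc, Category.assoc, Iso.inv_hom_id, Category.comp_id,
      S.ι_naturality, I_v, Category.assoc, ← hKd]
    simp only [Category.assoc, hs]
  clear hKd
  generalize S.k W.obj ≫ θ.inv = K at *
  generalize S.F.map W.v ≫ θ.inv = V at *
  generalize S.J.obj W.obj = Y at *
  -- The arrows in `K` start at the zero object, so the zero morphism serves as the identity at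
  -- their source.
  have hK0 : (0 : Y ⟶ T.X 1) = K ≫ T.p 0 ≫ T.s 0 := by rw [← Category.assoc, hKp, zero_comp]
  have hVp : V ≫ T.p 0 = fst Y ≫ K ≫ T.d 0 := by
    apply S.k_ι_jointlyEpic
    · rw [← Category.assoc, hkV, ← Category.assoc, k_fst, zero_comp, Category.assoc, hKp, comp_zero]
    · rw [← Category.assoc, hιV, ← Category.assoc _ (fst Y), ι_fst]
      simp
  have hVd : V ≫ T.d 0 = snd Y ≫ K ≫ T.d 0 := by
    apply S.k_ι_jointlyEpic
    · rw [← Category.assoc, hkV, ← Category.assoc, k_snd, Category.assoc]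
    · rw [← Category.assoc, hιV, ← Category.assoc _ (snd Y), ι_snd]
      simp
  obtain ⟨τ, hτ₁, hτ₂, hτ₃, hτ₄⟩ := exists_twist (S := S) Y
  -- `V` sends a pair `(a, b)` of kernel arrows to `a⁻¹ b`. It suffices to test on `k`, the pairs
  -- `(0, b)`, where `V` is `b`, and on `ι`, the pairs `(a, a)`, where `V` is an identity.
  have c₁ : T.Comp (fst Y ≫ K) V (snd Y ≫ K) := by
    obtain ⟨z, hz⟩ := Tower.Comp.exists_of (T := T) (f := fst Y ≫ K) (g := V) (by
      rw [hVp, Category.assoc])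
    have : z = snd Y ≫ K := by
      apply S.k_ι_jointlyEpic
      · have := hz.pre (S.k _)
        rw [← Category.assoc, k_fst, zero_comp, hkV] at this
        rw [← Category.assoc, k_snd]
        refine this.unique ?_
        have h' := Tower.Comp.id_left ((S.jG Y).hom ≫ K)
        rwa [Category.assoc, ← hK0, comp_zero] at h'
      · have := hz.pre (S.ι _)
        rw [← Category.assoc, ι_fst, hιV] at this
        rw [← Category.assoc, ι_snd]
        refine this.unique ?_
        have h' := Tower.Comp.id_right ((S.iG Y).hom ≫ K)
        rwa [Category.assoc] at h'
    rwa [this] at hz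
  -- `k ≫ τ` is the pair `(a, 0)`, at which `V` yields the inverse of `a`. Below, `c₃` says that `V
  -- (a, b)` followed by `V (b, a)` is an identity, which makes this inverse two-sided.
  have hjf : (S.k _ ≫ τ) ≫ fst Y = (S.jG Y).hom := by rw [Category.assoc, hτ₁, k_snd]
  have hjs : (S.k _ ≫ τ) ≫ snd Y = 0 := by rw [Category.assoc, hτ₂, k_fst]
  have c₂ : T.Comp ((S.jG Y).hom ≫ K) ((S.k _ ≫ τ) ≫ V) 0 := by
    have := c₁.pre (S.k _ ≫ τ)
    rwa [← Category.assoc, hjf, ← Category.assoc _ (snd Y), hjs, zero_comp] at this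
  have c₃ : T.Comp V (τ ≫ V) (fst Y ≫ K ≫ T.d 0 ≫ T.s 0) := by
    obtain ⟨z, hz⟩ := Tower.Comp.exists_of (T := T) (f := V) (g := τ ≫ V) (by
      rw [hVd, Category.assoc, hVp, ← Category.assoc τ, hτ₁])
    have : z = fst Y ≫ K ≫ T.d 0 ≫ T.s 0 := by
      apply S.k_ι_jointlyEpic
      · have := hz.pre (S.k _)
        rw [hkV, ← Category.assoc _ τ] at this
        rw [← Category.assoc, k_fst, zero_comp]
        exact this.unique c₂
      · have := hz.pre (S.ι _)
        rw [← Category.assoc _ τ, hτ₃, hιV] at this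
        rw [← Category.assoc, ι_fst]
        refine this.unique ?_
        have h' := Tower.Comp.id_right ((S.iG Y).hom ≫ K ≫ T.d 0 ≫ T.s 0)
        simpa using h'
    rwa [this] at hz
  have c₄ := c₃.pre (S.k _ ≫ τ)
  have hjV : (S.k _ ≫ τ) ≫ τ ≫ V = (S.jG Y).hom ≫ K := by
    rw [Category.assoc, ← Category.assoc τ τ, hτ₄, Category.id_comp, hkV]
  rw [← Category.assoc _ (fst Y), hjf, hjV] at c₄
  refine ⟨(S.jG Y).inv ≫ (S.k _ ≫ τ) ≫ V, ?_, ?_⟩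
  · simpa using c₂.pre (S.jG Y).inv
  · simpa using c₄.pre (S.jG Y).inv

/-- Let `D` be the point of composable pairs over their composite, with section `f ↦ (1, f)`, and
let `φ` be first projection over the source map. On kernels `φ` sends a pair `(f, g)` with composite
`0` to `f`; inverses of kernel arrows make this bijective, so `J φ` is invertible and `φ` is
cartesian. -/
theorem hasInverses [S.realization.IsEquivalence] (hS : S.JointlyConservative)
    (hp : T.p 0 ≫ e.hom = θ.hom ≫ S.π W.obj)
    (hd : T.d 0 ≫ e.hom = θ.hom ≫ S.hat W.u) (hs : T.s 0 ≫ θ.hom = e.hom ≫ S.ι W.obj) :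
    T.HasInverses := by
  obtain ⟨w, c₁, c₂⟩ := exists_ker_inv θ e hp hd hs
  obtain ⟨z, hz₁, hz₂, hz₃⟩ := id c₁
  obtain ⟨D, t, b, hπ, hι⟩ := exists_iso_point (S := S) (T.d 1) (T.t 0) (T.t_d 0)
  obtain ⟨φ, hF, hI⟩ := exists_hom (S := S) (C := D) (D := W.obj)
    (t.hom ≫ T.p 1 ≫ θ.hom) (b.hom ≫ T.p 0 ≫ e.hom) (by
      rw [← Category.assoc, hπ, Category.assoc, ← Category.assoc (T.d 1), T.d_p]
      simp [hp]) (by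
      rw [← Category.assoc, hι, Category.assoc, reassoc_of% (T.t_p 0), hs]
      simp)
  have hφ : S.J.map φ ≫ S.k W.obj ≫ θ.inv = S.k D ≫ t.hom ≫ T.p 1 := by
    rw [← Category.assoc, ← S.k_naturality, hF]
    simp
  have hK : Mono (S.k W.obj ≫ θ.inv) := inferInstance
  generalize S.k W.obj ≫ θ.inv = K at *
  obtain ⟨y, hy⟩ := exists_kernel_lift (C := D) (z ≫ t.inv) (by
    rw [← cancel_mono b.hom, Category.assoc, Category.assoc, hπ, Iso.inv_hom_id_assoc, hz₃,
      zero_comp])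
  have hyt : y ≫ S.k D ≫ t.hom = z := by rw [← Category.assoc, hy]; simp
  have hiso : IsIso (S.J.map φ) := by
    refine ⟨y, ?_, ?_⟩
    · rw [← cancel_mono (S.k D), ← cancel_mono t.hom, Category.id_comp, Category.assoc,
        Category.assoc, hyt]
      have hd : (S.k D ≫ t.hom) ≫ T.d 1 = 0 := by
        rw [Category.assoc, ← hπ, ← Category.assoc, S.k_π, zero_comp]
      have c₃ : T.Comp (S.J.map φ ≫ K) ((S.k D ≫ t.hom) ≫ T.q 0) 0 :=
        ⟨S.k D ≫ t.hom, by rw [hφ, Category.assoc], rfl, hd⟩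
      have c₄ := c₂.pre (S.J.map φ)
      have c₅ := c₄.assoc c₃ (c := (S.k D ≫ t.hom) ≫ T.q 0) (by
        have h₁ := Tower.Comp.id_left ((S.k D ≫ t.hom) ≫ T.q 0)
        rwa [← Category.assoc, ← c₃.mid, Category.assoc, Category.assoc] at h₁)
      have c₆ := Tower.Comp.id_right (S.J.map φ ≫ w)
      rw [Category.assoc, ← Category.assoc w, ← c₁.tgt, zero_comp, zero_comp, comp_zero] at c₆
      apply (T.isPullback 0).hom_ext
      · rw [Category.assoc, hz₁, hφ, Category.assoc]
      · rw [Category.assoc, hz₂, c₆.unique c₅]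
    · rw [← cancel_mono K, Category.assoc, hφ, ← Category.assoc, ← Category.assoc,
        Category.assoc y, hyt, hz₁, Category.id_comp]
  -- Lifting the identity over the section `s 0` of `p 0` completes each arrow `f` to a composable
  -- pair whose composite is the identity at the source of `f`.
  obtain ⟨l, hl, hl'⟩ := cartesian_lift (cartesian_of_isIso_J hS φ) (𝟙 _)
    (e.inv ≫ T.s 0 ≫ b.inv) (by
      rw [hI, S.I.map_id]
      simp)
  have hlF : S.F.map l ≫ S.F.map φ = 𝟙 _ := by rw [← S.F.map_comp, hl, S.F.map_id]
  refine ⟨θ.hom ≫ S.F.map l ≫ t.hom, ?_, ?_⟩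
  · rw [← cancel_mono θ.hom, Category.assoc, Category.assoc, Category.assoc, ← hF, hlF,
      Category.comp_id, Category.id_comp]
  · rw [Category.assoc, Category.assoc, ← hπ, ← Category.assoc (S.F.map l), S.π_naturality, hl']
    simp only [Category.assoc, Iso.inv_hom_id, Category.comp_id]
    rw [← reassoc_of% hp, Iso.hom_inv_id_assoc]

open Simplicial

theorem exists_groupoid_of_tower [S.realization.IsEquivalence] (hS : S.JointlyConservative)
    (hp : T.p 0 ≫ e.hom = θ.hom ≫ S.π W.obj)
    (hd : T.d 0 ≫ e.hom = θ.hom ≫ S.hat W.u) (hs : T.s 0 ≫ θ.hom = e.hom ≫ S.ι W.obj) :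
    ∃ X : SimplicialObject B, IsInternalGroupoid X ∧
      ∃ (a₁ : X _⦋1⦌ ≅ S.F.obj W.obj) (a₀ : X _⦋0⦌ ≅ S.I.obj W.obj),
        X.δ 1 ≫ a₀.hom = a₁.hom ≫ S.π W.obj ∧ X.δ 0 ≫ a₀.hom = a₁.hom ≫ S.hat W.u ∧
          X.σ 0 ≫ a₁.hom = a₀.hom ≫ S.ι W.obj := by
  obtain ⟨X, hX, a₁, a₀, h₁, h₀, h₂⟩ := Tower.exists_groupoid (hasInverses θ e hS hp hd hs)
  refine ⟨X, hX, a₁ ≪≫ θ, a₀ ≪≫ e, ?_, ?_, ?_⟩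
  · simp [reassoc_of% h₁, hp]
  · simp [reassoc_of% h₀, hd]
  · simp [reassoc_of% h₂, hs]

end

open Simplicial

theorem IsStar.exists_groupoid [S.realization.IsEquivalence] (hS : S.JointlyConservative)
    {W : Whitehead S.toFunctorTriple} (hW : IsStar W) :
    ∃ X : SimplicialObject B, IsInternalGroupoid X ∧
      ∃ (a₁ : X _⦋1⦌ ≅ S.F.obj W.obj) (a₀ : X _⦋0⦌ ≅ S.I.obj W.obj),
        X.δ 1 ≫ a₀.hom = a₁.hom ≫ S.π W.obj ∧ X.δ 0 ≫ a₀.hom = a₁.hom ≫ S.hat W.u ∧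
          X.σ 0 ≫ a₁.hom = a₀.hom ≫ S.ι W.obj := by
  obtain ⟨⟨V, rfl, x⟩, h⟩ := hW
  exact exists_groupoid_of_tower (T := tower V x h) (W := V 0) (x 0).θ (Iso.refl _) hS
    (Category.comp_id _) ((Category.comp_id _).trans (x 0).I_α)
    ((x 0).I_β.trans (Category.id_comp _).symm)

end Whitehead

end

section

/-! ### Internal groupoids as reflexive graphs -/

open Simplicial Opposite

section

variable {B : Type u₂} [Category.{v₂} B] {X Y : SimplicialObject B}

theorem δ_one_naturality (f : X ⟶ Y) {n : ℕ} (i : Fin (n + 2)) :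
    X.δ i ≫ f.app (op ⦋n⦌) = f.app (op ⦋n + 1⦌) ≫ Y.δ i := f.naturality _

theorem σ_naturality' (f : X ⟶ Y) {n : ℕ} (i : Fin (n + 1)) :
    X.σ i ≫ f.app (op ⦋n + 1⦌) = f.app (op ⦋n⦌) ≫ Y.σ i := f.naturality _

theorem map_δ_comp (X : SimplicialObject B) {m n : ℕ} (θ : ⦋m⦌ ⟶ ⦋n⦌) (i : Fin (n + 2)) :
    X.map (θ ≫ SimplexCategory.δ i).op = X.δ i ≫ X.map θ.op := by
  rw [op_comp, X.map_comp]
  rfl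

theorem map_comp_δ (X : SimplicialObject B) {m n : ℕ} (i : Fin (n + 2)) (θ : ⦋n + 1⦌ ⟶ ⦋m⦌) :
    X.map (SimplexCategory.δ i ≫ θ).op = X.map θ.op ≫ X.δ i := by
  rw [op_comp, X.map_comp]
  rfl

/-- The simplices of an internal category are determined by their edges. -/
theorem IsInternalCategory.ext_edges (hX : IsInternalCategory X) (n : ℕ) {W : B}
    {f g : W ⟶ X _⦋n⦌} (h : ∀ ε : ⦋1⦌ ⟶ ⦋n⦌, f ≫ X.map ε.op = g ≫ X.map ε.op) : f = g := by
  induction n with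
  | zero =>
    have h' : f ≫ X.σ 0 = g ≫ X.σ 0 := h (SimplexCategory.σ 0)
    have e : X.σ (0 : Fin 1) ≫ X.δ 0 = 𝟙 _ := X.δ_comp_σ_self
    rw [← Category.comp_id f, ← Category.comp_id g, ← e, reassoc_of% h']
  | succ n ih =>
    cases n with
    | zero => simpa using h (𝟙 _)
    | succ n =>
      apply (hX n).hom_ext
      · refine ih fun ε => ?_
        have := h (ε ≫ SimplexCategory.δ (Fin.last (n + 2)))
        rwa [map_δ_comp, ← Category.assoc, ← Category.assoc] at this
      · refine ih fun ε => ?_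
        have := h (ε ≫ SimplexCategory.δ 0)
        rwa [map_δ_comp, ← Category.assoc, ← Category.assoc] at this

theorem exists_of_edge {n : ℕ} (ε : ⦋1⦌ ⟶ ⦋n + 1⦌) (i : Fin (n + 2)) (h₀ : ε.toOrderHom 0 ≠ i)
    (h₁ : ε.toOrderHom 1 ≠ i) : ∃ ε' : ⦋1⦌ ⟶ ⦋n⦌, ε = ε' ≫ SimplexCategory.δ i := by
  apply SimplexCategory.eq_comp_δ_of_not_surjective'
  intro x
  fin_cases x
  · exact h₀
  · exact h₁

/-! ### Extension of a morphism of reflexive graphs to a simplicial morphism. -/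

section Extend

variable (hY : IsInternalCategory Y)
  (hσ : JointlyEpic (X.σ (0 : Fin 2)) (X.σ 1)) (t : X _⦋1⦌ ⟶ Y _⦋1⦌) (b : X _⦋0⦌ ⟶ Y _⦋0⦌)
  (h₁ : X.δ 1 ≫ b = t ≫ Y.δ 1) (h₀ : X.δ 0 ≫ b = t ≫ Y.δ 0) (hs : X.σ 0 ≫ t = b ≫ Y.σ 0)

-- The outer faces define the map on composable pairs. It preserves composition because both sides
-- agree on the two degeneracies, which are jointly epic.
include hY hσ h₁ h₀ hs in
theorem exists_map_two : ∃ f : X _⦋2⦌ ⟶ Y _⦋2⦌, f ≫ Y.δ 2 = X.δ 2 ≫ t ∧ f ≫ Y.δ 0 = X.δ 0 ≫ t ∧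
    f ≫ Y.δ 1 = X.δ 1 ≫ t := by
  have hY0 := hY 0
  have hXd : X.δ (2 : Fin 3) ≫ X.δ (0 : Fin 2) = X.δ 0 ≫ X.δ 1 :=
    (X.δ_comp_δ (n := 0) (i := 0) (j := 1) (by simp))
  have hw : (X.δ (2 : Fin 3) ≫ t) ≫ Y.δ (0 : Fin 2) = (X.δ 0 ≫ t) ≫ Y.δ (Fin.last 1) := by
    have h₁' : X.δ (Fin.last 1) ≫ b = t ≫ Y.δ (Fin.last 1) := h₁
    rw [Category.assoc, ← h₀, Category.assoc, ← h₁', reassoc_of% hXd]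
    rfl
  obtain ⟨f, hf₂, hf₀⟩ : ∃ f : X _⦋2⦌ ⟶ Y _⦋2⦌, f ≫ Y.δ 2 = X.δ 2 ≫ t ∧ f ≫ Y.δ 0 = X.δ 0 ≫ t :=
    ⟨hY0.lift _ _ hw, hY0.lift_fst _ _ hw, hY0.lift_snd _ _ hw⟩
  have x₀₀ : X.σ (0 : Fin 2) ≫ X.δ 0 = 𝟙 _ := X.δ_comp_σ_self
  have x₀₁ : X.σ (0 : Fin 2) ≫ X.δ 1 = 𝟙 _ := X.δ_comp_σ_succ
  have x₁₁ : X.σ (1 : Fin 2) ≫ X.δ 1 = 𝟙 _ := X.δ_comp_σ_self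
  have x₁₂ : X.σ (1 : Fin 2) ≫ X.δ 2 = 𝟙 _ := X.δ_comp_σ_succ
  have x₀₂ : X.σ (0 : Fin 2) ≫ X.δ 2 = X.δ 1 ≫ X.σ 0 :=
    X.δ_comp_σ_of_gt (n := 0) (i := 1) (j := 0) (by simp)
  have x₁₀ : X.σ (1 : Fin 2) ≫ X.δ 0 = X.δ 0 ≫ X.σ 0 :=
    X.δ_comp_σ_of_le (n := 0) (i := 0) (j := 0) (by simp)
  have y₀₀ : Y.σ (0 : Fin 2) ≫ Y.δ 0 = 𝟙 _ := Y.δ_comp_σ_self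
  have y₀₁ : Y.σ (0 : Fin 2) ≫ Y.δ 1 = 𝟙 _ := Y.δ_comp_σ_succ
  have y₁₁ : Y.σ (1 : Fin 2) ≫ Y.δ 1 = 𝟙 _ := Y.δ_comp_σ_self
  have y₁₂ : Y.σ (1 : Fin 2) ≫ Y.δ 2 = 𝟙 _ := Y.δ_comp_σ_succ
  have y₀₂ : Y.σ (0 : Fin 2) ≫ Y.δ 2 = Y.δ 1 ≫ Y.σ 0 :=
    Y.δ_comp_σ_of_gt (n := 0) (i := 1) (j := 0) (by simp)
  have y₁₀ : Y.σ (1 : Fin 2) ≫ Y.δ 0 = Y.δ 0 ≫ Y.σ 0 :=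
    Y.δ_comp_σ_of_le (n := 0) (i := 0) (j := 0) (by simp)
  have e₀ : X.σ 0 ≫ f = t ≫ Y.σ 0 := by
    apply hY0.hom_ext
    · change (X.σ 0 ≫ f) ≫ Y.δ 2 = (t ≫ Y.σ 0) ≫ Y.δ 2
      rw [Category.assoc, Category.assoc, hf₂, y₀₂, reassoc_of% x₀₂, hs, reassoc_of% h₁]
    · rw [Category.assoc, Category.assoc, hf₀, y₀₀, reassoc_of% x₀₀, Category.comp_id]
  have e₁ : X.σ 1 ≫ f = t ≫ Y.σ 1 := by
    apply hY0.hom_ext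
    · change (X.σ 1 ≫ f) ≫ Y.δ 2 = (t ≫ Y.σ 1) ≫ Y.δ 2
      rw [Category.assoc, Category.assoc, hf₂, y₁₂, reassoc_of% x₁₂, Category.comp_id]
    · rw [Category.assoc, Category.assoc, hf₀, y₁₀, reassoc_of% x₁₀, hs, reassoc_of% h₀]
  refine ⟨f, hf₂, hf₀, hσ _ _ ?_ ?_⟩
  · rw [reassoc_of% e₀, y₀₁, reassoc_of% x₀₁, Category.comp_id]
  · rw [reassoc_of% e₁, y₁₁, reassoc_of% x₁₁, Category.comp_id]

include hY hσ h₁ h₀ hs in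
/-- A morphism of graphs extends to simplices, compatibly with edges. -/
theorem exists_map_of_edges (n : ℕ) :
    ∃ f : X _⦋n⦌ ⟶ Y _⦋n⦌, ∀ ε : ⦋1⦌ ⟶ ⦋n⦌, f ≫ Y.map ε.op = X.map ε.op ≫ t := by
  have hzero (ε : ⦋1⦌ ⟶ ⦋0⦌) : b ≫ Y.map ε.op = X.map ε.op ≫ t := by
    obtain rfl : ε = SimplexCategory.σ 0 := Subsingleton.elim _ _
    exact hs.symm
  induction n with
  | zero => exact ⟨b, hzero⟩
  | succ n ih =>
    cases n with
    | zero =>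
      refine ⟨t, fun ε => ?_⟩
      by_cases e₀ : ε.toOrderHom 0 = 0
      · by_cases e₁ : ε.toOrderHom 1 = 1
        · obtain rfl : ε = 𝟙 _ := by
            ext i : 3
            fin_cases i
            · exact e₀
            · exact e₁
          simp
        · obtain ⟨ε, rfl⟩ := exists_of_edge ε 1 (by rw [e₀]; simp) e₁
          rw [map_δ_comp, map_δ_comp, ← reassoc_of% h₁, hzero, Category.assoc]
      · obtain ⟨ε, rfl⟩ := exists_of_edge ε 0 e₀ (fun h => e₀ (by
          have := ε.toOrderHom.monotone (Fin.zero_le 1)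
          exact le_antisymm (this.trans h.le) (Fin.zero_le _)))
        rw [map_δ_comp, map_δ_comp, ← reassoc_of% h₀, hzero, Category.assoc]
    | succ n =>
      obtain ⟨f', hf'⟩ := ih
      obtain ⟨m, hm₂, hm₀, hm₁⟩ := exists_map_two hY hσ t b h₁ h₀ hs
      have hw : (X.δ (Fin.last (n + 2)) ≫ f') ≫ Y.δ 0 = (X.δ 0 ≫ f') ≫ Y.δ (Fin.last (n + 1)) := by
        apply hY.ext_edges
        intro ε
        have hX : X.δ (Fin.last (n + 2)) ≫ X.δ 0 = X.δ 0 ≫ X.δ (Fin.last (n + 1)) :=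
          X.δ_comp_δ (n := n) (i := 0) (j := Fin.last (n + 1)) (Fin.zero_le _)
        simp only [Category.assoc, ← map_δ_comp, hf']
        simp only [map_δ_comp]
        simp only [Category.assoc]
        rw [reassoc_of% hX]
      obtain ⟨f, hf₁, hf₀⟩ : ∃ f, f ≫ Y.δ (Fin.last (n + 2)) = X.δ (Fin.last (n + 2)) ≫ f' ∧
          f ≫ Y.δ 0 = X.δ 0 ≫ f' :=
        ⟨(hY n).lift _ _ hw, (hY n).lift_fst _ _ hw, (hY n).lift_snd _ _ hw⟩
      have hlast (ε : ⦋1⦌ ⟶ ⦋n + 2⦌) (h₁ : ε.toOrderHom 1 ≠ Fin.last (n + 2)) :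
          f ≫ Y.map ε.op = X.map ε.op ≫ t := by
        obtain ⟨ε, rfl⟩ := exists_of_edge ε _ (fun h => h₁ (by
          have := ε.toOrderHom.monotone (Fin.zero_le 1)
          exact le_antisymm (Fin.le_last _) (h.ge.trans this))) h₁
        rw [map_δ_comp, map_δ_comp, reassoc_of% hf₁, hf', Category.assoc]
      have hfirst (ε : ⦋1⦌ ⟶ ⦋n + 2⦌) (h₀ : ε.toOrderHom 0 ≠ 0) :
          f ≫ Y.map ε.op = X.map ε.op ≫ t := by
        obtain ⟨ε, rfl⟩ := exists_of_edge ε 0 h₀ (fun h => h₀ (by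
          have := ε.toOrderHom.monotone (Fin.zero_le 1)
          exact le_antisymm (this.trans h.le) (Fin.zero_le _)))
        rw [map_δ_comp, map_δ_comp, reassoc_of% hf₀, hf', Category.assoc]
      refine ⟨f, fun ε => ?_⟩
      by_cases e₁ : ε.toOrderHom 1 = Fin.last (n + 2)
      · by_cases e₀ : ε.toOrderHom 0 = 0
        -- The edge from the first to the last vertex is the only one in neither outer face. It is
        -- the composite edge of the triangle `0, 1, last`, whose other two edges are already
        -- handled.
        · let τ : ⦋2⦌ ⟶ ⦋n + 2⦌ := SimplexCategory.mkHom
            ⟨![0, 1, Fin.last (n + 2)], by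
              rw [Fin.monotone_iff_le_succ]
              intro i
              fin_cases i
              · exact Fin.zero_le _
              · exact Fin.le_last _⟩
          have hε : ε = SimplexCategory.δ 1 ≫ τ := by
            ext i : 3
            fin_cases i
            · exact e₀
            · exact e₁
          have hτ : f ≫ Y.map τ.op = X.map τ.op ≫ m := by
            apply (hY 0).hom_ext
            · change (f ≫ Y.map τ.op) ≫ Y.δ 2 = (X.map τ.op ≫ m) ≫ Y.δ 2
              rw [Category.assoc, Category.assoc, hm₂, ← map_comp_δ, ← Category.assoc,
                ← map_comp_δ]
              apply hlast
              change (1 : Fin (n + 3)) ≠ Fin.last (n + 2)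
              simp [Fin.ext_iff]
            · rw [Category.assoc, Category.assoc, hm₀, ← map_comp_δ, ← Category.assoc,
                ← map_comp_δ]
              apply hfirst
              change (1 : Fin (n + 3)) ≠ 0
              simp
          rw [hε, map_comp_δ, map_comp_δ, reassoc_of% hτ, hm₁, Category.assoc]
        · exact hfirst ε e₀
      · exact hlast ε e₁

include hY hσ h₁ h₀ hs in
theorem exists_hom_of_graph : ∃ f : X ⟶ Y, f.app (op ⦋1⦌) = t ∧ f.app (op ⦋0⦌) = b := by
  have key (Δ : SimplexCategory) : ∃ f : X.obj (op Δ) ⟶ Y.obj (op Δ),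
      ∀ ε : ⦋1⦌ ⟶ Δ, f ≫ Y.map ε.op = X.map ε.op ≫ t := by
    induction Δ using SimplexCategory.rec with
    | mk n => exact exists_map_of_edges hY hσ t b h₁ h₀ hs n
  have hext (Δ : SimplexCategory) {W : B} {f g : W ⟶ Y.obj (op Δ)}
      (h : ∀ ε : ⦋1⦌ ⟶ Δ, f ≫ Y.map ε.op = g ≫ Y.map ε.op) : f = g := by
    induction Δ using SimplexCategory.rec with
    | mk n => exact hY.ext_edges n h
  choose f hf using key
  refine ⟨⟨fun Δ => f Δ.unop, fun {Δ Δ'} θ => ?_⟩, ?_, ?_⟩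
  · apply hext Δ'.unop
    intro ε
    have h' := hf Δ.unop (ε ≫ θ.unop)
    rw [op_comp, Y.map_comp, X.map_comp, Category.assoc] at h'
    rw [Category.assoc, Category.assoc, hf]
    exact h'.symm
  · simpa using hf ⦋1⦌ (𝟙 _)
  · have h' : f ⦋0⦌ ≫ Y.σ 0 = X.σ 0 ≫ t := hf ⦋0⦌ (SimplexCategory.σ 0)
    have e : Y.σ (0 : Fin 1) ≫ Y.δ 0 = 𝟙 _ := Y.δ_comp_σ_self
    change f ⦋0⦌ = b
    rw [hs] at h'
    rw [← Category.comp_id (f ⦋0⦌), ← Category.comp_id b, ← e, reassoc_of% h']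

end Extend

variable (B) in
/-- The reflexive graph of an internal groupoid. -/
def Gpd.toRGraph : Gpd B ⥤ RGraph B where
  obj X := ⟨⟨X.obj _⦋1⦌, X.obj _⦋0⦌, X.obj.δ 1, X.obj.σ 0, X.obj.δ_comp_σ_succ⟩, X.obj.δ 0,
    X.obj.δ_comp_σ_self⟩
  map f := ⟨⟨f.hom.app _, f.hom.app _, δ_one_naturality _ _, σ_naturality' _ _⟩,
    δ_one_naturality _ _⟩
  map_id _ := rfl
  map_comp _ _ := rfl

end

variable {A : Type u₁} [Category.{v₁} A] {B : Type u₂} [Category.{v₂} B] [HasZeroMorphisms B]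

/-- The two unit sections of the object of composable pairs of a reflexive graph. -/
theorem jointlyEpic_of_isPullback (S : ActionSystem A B) [S.realization.EssSurj]
    {X₀ X₁ X₂ : B} {p d : X₁ ⟶ X₀} {s : X₀ ⟶ X₁} {p' q : X₂ ⟶ X₁} {t s' : X₁ ⟶ X₂}
    (h : IsPullback p' q d p) (s'_p' : s' ≫ p' = 𝟙 _) (t_q : t ≫ q = 𝟙 _)
    (t_p' : t ≫ p' = p ≫ s) : JointlyEpic t s' := by
  obtain ⟨C, a, b, hπ, hι⟩ := ActionSystem.exists_iso_point (S := S) p' s' s'_p'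
  have hk : S.k C ≫ a.hom ≫ p' = 0 := by rw [← hπ, ← Category.assoc, S.k_π, zero_comp]
  -- A pair in the kernel of `p'` is `(0, g)` with `g` starting at the zero object, hence `(1, g)`:
  -- the kernel factors through `t`.
  have e : S.k C ≫ a.hom = (S.k C ≫ a.hom ≫ q) ≫ t := by
    apply h.hom_ext
    · simp only [Category.assoc, hk, t_p', ← reassoc_of% h.w]
      rw [reassoc_of% hk, zero_comp]
    · simp only [Category.assoc, t_q, Category.comp_id]
  intro W f g h₀ h₁
  rw [← cancel_epi a.hom]
  apply S.k_ι_jointlyEpic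
  · rw [← Category.assoc, ← Category.assoc, e, Category.assoc, Category.assoc, h₀]
    simp only [Category.assoc]
  · rw [reassoc_of% hι, reassoc_of% hι, h₁]

theorem jointlyEpic_σ (S : ActionSystem A B) [S.realization.EssSurj] {X : SimplicialObject B}
    (hX : IsInternalCategory X) : JointlyEpic (X.σ (0 : Fin 2)) (X.σ 1) :=
  jointlyEpic_of_isPullback S (hX 0) X.δ_comp_σ_succ X.δ_comp_σ_self
    (X.δ_comp_σ_of_gt (n := 0) (i := 1) (j := 0) (by simp))

instance : (Gpd.toRGraph B).Faithful where
  map_injective {X Y f g} h := by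
    have h₁ : f.hom.app (op ⦋1⦌) = g.hom.app (op ⦋1⦌) := congrArg (fun φ => φ.pt.top) h
    ext Δ
    induction Δ using Opposite.rec with | op Δ
    induction Δ using SimplexCategory.rec with | mk n
    apply Y.property.1.ext_edges
    intro ε
    rw [← f.hom.naturality, ← g.hom.naturality, h₁]

theorem Gpd.full_toRGraph (S : ActionSystem A B) [S.realization.EssSurj] :
    (Gpd.toRGraph B).Full where
  map_surjective {X Y} φ := by
    obtain ⟨f, h₁, h₀⟩ := exists_hom_of_graph Y.property.1 (jointlyEpic_σ S X.property.1)
      φ.pt.top φ.pt.base φ.pt.proj_comm φ.d_comm φ.pt.sec_comm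
    exact ⟨⟨f⟩, RGraph.Hom.ext (Pt.hom_ext h₁ h₀)⟩

end

open Simplicial Opposite

/-! ### The tower of an internal groupoid -/

section

variable {B : Type u₂} [Category.{v₂} B] {X : SimplicialObject B}

/-- In an internal category the last face and the last inner face form a pullback. -/
theorem IsInternalCategory.isPullback_last (hX : IsInternalCategory X) (n : ℕ) :
    IsPullback (X.δ (Fin.last (n + 2))) (X.δ (Fin.last n).castSucc.castSucc)
      (X.δ (Fin.last n).castSucc) (X.δ (Fin.last (n + 1))) := by
  induction n with
  | zero => exact hX 0
  | succ n ih =>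
    have e₁ : X.δ (Fin.last (n + 1)).castSucc ≫ X.δ 0 = X.δ 0 ≫ X.δ (Fin.last n).castSucc :=
      X.δ_comp_δ (n := n) (i := 0) (j := (Fin.last n).castSucc) (Fin.zero_le _)
    have e₂ : X.δ (Fin.last (n + 1)).castSucc.castSucc ≫ X.δ 0 =
        X.δ 0 ≫ X.δ (Fin.last n).castSucc.castSucc :=
      X.δ_comp_δ (n := n + 1) (i := 0) (j := (Fin.last n).castSucc.castSucc) (Fin.zero_le _)
    have e₃ : X.δ (Fin.last (n + 3)) ≫ X.δ (Fin.last (n + 1)).castSucc =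
        X.δ (Fin.last (n + 1)).castSucc.castSucc ≫ X.δ (Fin.last (n + 2)) :=
      X.δ_comp_δ (n := n + 1) (i := (Fin.last (n + 1)).castSucc) (j := Fin.last (n + 2))
        (Fin.le_last _)
    -- The square is pasted onto the outer-face square below it; since faces commute with `δ 0`, the
    -- composite rectangle is also an outer-face square pasted with the previous case.
    refine IsPullback.of_bot ?_ e₃ (hX n)
    rw [e₁, e₂]
    exact (hX (n + 1)).paste_vert ih

end

section

variable {A : Type u₁} [Category.{v₁} A] {B : Type u₂} [Category.{v₂} B] [HasZeroMorphisms B]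
  (S : ActionSystem A B)

/-- The tower of last faces of an internal category. -/
def IsInternalCategory.tower [S.realization.EssSurj] {X : SimplicialObject B}
    (hX : IsInternalCategory X) : Tower B where
  X n := X _⦋n⦌
  p n := X.δ (Fin.last (n + 1))
  d n := X.δ (Fin.last n).castSucc
  s n := X.σ (Fin.last n)
  q n := X.δ (Fin.last n).castSucc.castSucc
  t n := X.σ (Fin.last n).castSucc
  s_p n := X.δ_comp_σ_succ
  s_d n := X.δ_comp_σ_self
  isPullback n := hX.isPullback_last n
  t_p n := X.δ_comp_σ_of_gt (i := Fin.last (n + 1)) (j := Fin.last n) (Fin.castSucc_lt_last _)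
  t_q n := X.δ_comp_σ_self
  t_d n := by
    have := X.δ_comp_σ_succ (i := (Fin.last n).castSucc)
    rwa [Fin.succ_castSucc, Fin.succ_last] at this
  s_q n := X.δ_comp_σ_of_le (i := (Fin.last n).castSucc) (j := Fin.last n) le_rfl
  jointlyEpic n := jointlyEpic_of_isPullback S (hX.isPullback_last n) X.δ_comp_σ_succ
    X.δ_comp_σ_self
    (X.δ_comp_σ_of_gt (i := Fin.last (n + 1)) (j := Fin.last n) (Fin.castSucc_lt_last _))

theorem IsInternalGroupoid.hasInverses [S.realization.EssSurj] {X : SimplicialObject B}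
    (hX : IsInternalGroupoid X) : (hX.1.tower S).HasInverses := by
  obtain ⟨i, l, r, ⟨h₂, h₀, h₁⟩, -⟩ := hX.2
  exact ⟨l, h₂, h₁⟩

end

/-! ### The Whitehead sequence of a tower with inverses -/

namespace Whitehead

open ActionSystem

variable {A : Type u₁} [Category.{v₁} A] {B : Type u₂} [Category.{v₂} B] [HasZeroMorphisms B]
  {S : ActionSystem A B}

theorem isWhitehead_of {C : A} {u : C ⟶ S.G.obj (S.I.obj C)} {v : S.G.obj (S.J.obj C) ⟶ C}
    (hu : S.ι C ≫ S.hat u = 𝟙 _) (hJ : S.J.map v = (S.jG _).hom)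
    (hI : S.I.map v = (S.iG _).hom ≫ S.k C ≫ S.hat u) : S.IsWhitehead u v where
  I_u := by rw [← ι_hat, hu]
  J_v := by rw [hJ, Iso.inv_hom_id]
  I_v := by rw [hI, Iso.inv_hom_id_assoc, k_hat]

/-- Converse to `exists_ker_inv`: division `V (a, b) = a⁻¹ b` of kernel arrows is a morphism of
points out of `F G J C`, hence of the form `F v`. -/
theorem exists_isWhitehead_of_hasInverses [S.realization.Full] {T : Tower B} (hT : T.HasInverses)
    {C : A} (θ : T.X 1 ≅ S.F.obj C) (e : T.X 0 ≅ S.I.obj C) (u : C ⟶ S.G.obj (S.I.obj C))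
    (hp : T.p 0 ≫ e.hom = θ.hom ≫ S.π C) (hd : T.d 0 ≫ e.hom = θ.hom ≫ S.hat u)
    (hs : T.s 0 ≫ θ.hom = e.hom ≫ S.ι C) : ∃ v, S.IsWhitehead u v := by
  obtain ⟨K, hK⟩ : ∃ K : S.J.obj C ⟶ T.X 1, K ≫ θ.hom = S.k C := ⟨S.k C ≫ θ.inv, by simp⟩
  have hKp : K ≫ T.p 0 = 0 := by
    rw [← cancel_mono e.hom, Category.assoc, hp, reassoc_of% hK, k_π, zero_comp]
  have hKd : K ≫ T.d 0 ≫ e.hom = S.k _ ≫ S.hat u := by rw [hd, reassoc_of% hK]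
  have hu : S.ι C ≫ S.hat u = 𝟙 _ := by
    rw [← cancel_epi e.hom, ← reassoc_of% hs, ← hd, T.s_d_assoc, Category.comp_id]
  obtain ⟨V, hV⟩ := hT.exists_div (f := fst (S := S) (S.J.obj C) ≫ K)
      (f' := snd (S := S) (S.J.obj C) ≫ K) (by
    rw [Category.assoc, Category.assoc, hKp, comp_zero, comp_zero])
  have hkV : S.k _ ≫ V = (S.jG _).hom ≫ K := by
    have h₁ := hV.pre (S.k _)
    rw [← Category.assoc, k_fst, zero_comp, ← Category.assoc, k_snd] at h₁
    have h₂ := Tower.Comp.id_left ((S.jG _).hom ≫ K)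
    rw [Category.assoc, reassoc_of% hKp, zero_comp, comp_zero] at h₂
    exact hT.div_unique h₁ h₂
  have hιV : S.ι _ ≫ V = (S.iG _).hom ≫ K ≫ T.d 0 ≫ T.s 0 := by
    have h₁ := hV.pre (S.ι _)
    rw [← Category.assoc, ι_fst, ← Category.assoc, ι_snd] at h₁
    have h₂ := Tower.Comp.id_right ((S.iG _).hom ≫ K)
    rw [Category.assoc] at h₂
    exact hT.div_unique h₁ h₂
  obtain ⟨v, hF, hI⟩ := exists_hom (S := S) (C := S.G.obj (S.J.obj C)) (D := C) (V ≫ θ.hom)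
    ((S.iG _).hom ≫ S.k C ≫ S.hat u) (by
      rw [Category.assoc, ← hp, ← reassoc_of% hV.mid, hKd, fst]
      simp) (by
      rw [reassoc_of% hιV, hs, Category.assoc, Category.assoc, ← reassoc_of% hKd])
  refine ⟨v, isWhitehead_of hu ?_ hI⟩
  rw [← cancel_mono (S.k C), ← S.k_naturality, hF, reassoc_of% hkV, hK]

/-- The arrow `v'` is the lift of `G J α ≫ v` along `α` whose `I`-component is the one that `u'`
forces; cancelling the invertible `J α` gives the condition on `J v'`. -/
theorem exists_isWhitehead_of_cartesian [S.realization.Faithful] {C E : A} {α : E ⟶ C}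
    (hα : S.Cartesian α) {u : C ⟶ S.G.obj (S.I.obj C)} {v : S.G.obj (S.J.obj C) ⟶ C}
    (h : S.IsWhitehead u v) {u' : E ⟶ S.G.obj (S.I.obj E)} (hu : S.ι E ≫ S.hat u' = 𝟙 _)
    (hα' : S.hat u' ≫ S.I.map α = S.F.map α ≫ S.hat u) : ∃ v', S.IsWhitehead u' v' := by
  have hv := J_v ⟨C, u, v, h⟩
  have hv' := I_v ⟨C, u, v, h⟩
  dsimp only at hv hv'
  obtain ⟨v', h₁, h₂⟩ := cartesian_lift hα (S.G.map (S.J.map α) ≫ v)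
    ((S.iG _).hom ≫ S.k E ≫ S.hat u') (by
      rw [Category.assoc, Category.assoc, hα', ← Category.assoc (S.k E), S.k_naturality,
        S.I.map_comp, hv', ← Category.assoc (S.I.map (S.G.map _)), S.iG_naturality]
      simp)
  refine ⟨v', isWhitehead_of hu ?_ h₂⟩
  have := S.isIso_J_map _ hα
  rw [← cancel_mono (S.J.map α), ← S.J.map_comp, h₁, S.J.map_comp, hv, S.jG_naturality]

/-- Let `C n` realize the point `(p n, s n)`. Then `α n` is given by `(q n, d n)`, `β n` by `(t n, s
n)`, and `u n` is adjoint to `d n`. The pullback of the tower is the naturality square of `π` at `α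
n`, which gives both cartesianness and the condition for `W*`. Inverses are needed only for `v 0`;
the later `v n` are lifted. -/
theorem exists_isStar_of_tower [S.realization.IsEquivalence] {T : Tower B} (hT : T.HasInverses) :
    ∃ W : Whitehead S.toFunctorTriple, IsStar W ∧
      ∃ (θ : S.F.obj W.obj ≅ T.X 1) (e : S.I.obj W.obj ≅ T.X 0),
        S.π W.obj ≫ e.hom = θ.hom ≫ T.p 0 ∧ S.hat W.u ≫ e.hom = θ.hom ≫ T.d 0 ∧
          S.ι W.obj ≫ θ.hom = e.hom ≫ T.s 0 := by
  choose C t b hπ hι using fun n => exists_iso_point (S := S) (T.p n) (T.s n) (T.s_p n)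
  let u (n : ℕ) : C n ⟶ S.G.obj (S.I.obj (C n)) :=
    S.η _ ≫ S.G.map ((t n).hom ≫ T.d n ≫ (b n).inv)
  have hu (n : ℕ) : S.hat (u n) = (t n).hom ≫ T.d n ≫ (b n).inv := (eq_hat rfl).symm
  have hιu (n : ℕ) : S.ι _ ≫ S.hat (u n) = 𝟙 _ := by
    rw [hu, reassoc_of% (hι n), T.s_d_assoc, Iso.hom_inv_id]
  have hπ' (n : ℕ) : (t n).inv ≫ S.π (C n) = T.p n ≫ (b n).inv := by
    rw [Iso.inv_comp_eq, ← Category.assoc, Iso.eq_comp_inv, hπ]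
  have hι' (n : ℕ) : (b n).inv ≫ S.ι (C n) = T.s n ≫ (t n).inv := by
    rw [Iso.inv_comp_eq, ← Category.assoc, Iso.eq_comp_inv, hι]
  have hα (n : ℕ) := exists_hom (S := S) ((t (n + 1)).hom ≫ T.q n ≫ (t n).inv)
    ((b (n + 1)).hom ≫ T.d n ≫ (b n).inv) (by
      rw [reassoc_of% (hπ (n + 1)), Category.assoc, Category.assoc, hπ', reassoc_of% (T.p_d n)])
    (by
      rw [reassoc_of% (hι (n + 1)), Category.assoc, Category.assoc, hι', reassoc_of% (T.s_q n)])
  choose α hαF hαI using hα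
  have hβ (n : ℕ) := exists_hom (S := S) ((t n).hom ≫ T.t n ≫ (t (n + 1)).inv)
    ((b n).hom ≫ T.s n ≫ (b (n + 1)).inv) (by
      rw [reassoc_of% (hπ n), Category.assoc, Category.assoc, hπ', reassoc_of% (T.t_p n)])
    (by
      rw [reassoc_of% (hι n), Category.assoc, Category.assoc, hι',
        reassoc_of% (T.s_t n)])
  choose β hβF hβI using hβ
  have hpb (n : ℕ) : IsPullback (S.π (C (n + 1))) (S.F.map (α n)) (S.I.map (α n)) (S.π (C n)) := by
    refine IsPullback.of_iso (T.isPullback n) (t (n + 1)).symm (b (n + 1)).symm (t n).symm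
      (b n).symm ?_ ?_ ?_ ?_
    · exact (hπ' _).symm
    · simp [hαF]
    · simp [hαI]
    · exact (hπ' _).symm
  have hcart (n : ℕ) : S.Cartesian (α n) := cartesian_of_isPullback _ (hpb n)
  have hαu (n : ℕ) : S.hat (u (n + 1)) ≫ S.I.map (α n) = S.F.map (α n) ≫ S.hat (u n) := by
    simp only [hu, hαI, hαF, Category.assoc, Iso.inv_hom_id_assoc]
    rw [reassoc_of% (T.d_d n)]
  have hv (n : ℕ) : ∃ v, S.IsWhitehead (u n) v := by
    induction n with
    | zero =>
      refine exists_isWhitehead_of_hasInverses hT (t 0).symm (b 0).symm (u 0) (hπ' 0).symm ?_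
        (hι' 0).symm
      simp [hu]
    | succ n ih =>
      obtain ⟨v, hv⟩ := ih
      exact exists_isWhitehead_of_cartesian (hcart n) hv (hιu _) (hαu n)
  choose v hv using hv
  let W (n : ℕ) : Whitehead S.toFunctorTriple := ⟨C n, u n, v n, hv n⟩
  let x (n : ℕ) : Step (W n) (W (n + 1)) :=
    { α := α n
      β := β n
      θ := b (n + 1) ≪≫ (t n).symm
      cartesian := hcart n
      β_α := by
        refine hom_ext_F_I (S := S) ?_ ?_
        · rw [S.F.map_comp, hαF, hβF, S.F.map_id]
          simp
        · rw [S.I.map_comp, hαI, hβI, S.I.map_id]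
          simp
      η_α := by
        rw [hαI]
        simp [W, u]
      I_β := by
        rw [hβI]
        simp [W, ← reassoc_of% (hι n)]
      β_u := by
        apply hat_injective
        rw [hat_comp, hβF, hat_comp_map, hu, ← eq_hat (h := 𝟙 _) (by simp)]
        simp
      v_α := v_comm_of_hat (W := W (n + 1)) (W' := W n) (α n) (hαu n) }
  refine ⟨W 0, ⟨⟨W, rfl, x⟩, hpb⟩, t 0, b 0, hπ 0, ?_, hι 0⟩
  change S.hat (u 0) ≫ _ = _
  simp [hu]

end Whitehead

/-! ### The equivalence -/

/-- Fully faithful functors with the same essential image have equivalent sources. -/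
theorem nonempty_equivalence_of_essImage_eq {C D E : Type*} [Category C] [Category D] [Category E]
    (F : C ⥤ E) (G : D ⥤ E) [F.Full] [F.Faithful] [G.Full] [G.Faithful]
    (h : F.essImage = G.essImage) : Nonempty (C ≌ D) := by
  -- Stating this for a variable `P` lets the equality of essential images be substituted, with no
  -- transport between full subcategories.
  have key (P : ObjectProperty E) (hP : G.essImage = P) : Nonempty (D ≌ P.FullSubcategory) := by
    subst hP
    have : G.toEssImage.IsEquivalence := {}
    exact ⟨G.toEssImage.asEquivalence⟩
  obtain ⟨e⟩ := key _ h.symm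
  have : F.toEssImage.IsEquivalence := {}
  exact ⟨F.toEssImage.asEquivalence.trans e.symm⟩

end

end ActionSystems

theorem theorem2 {A : Type u₁} [CategoryTheory.Category.{v₁} A]
    {B : Type u₂} [CategoryTheory.Category.{v₂} B]
    [CategoryTheory.Limits.HasZeroObject B] [CategoryTheory.Limits.HasZeroMorphisms B]
    (S : ActionSystems.ActionSystem A B)
    (hcons : S.JointlyConservative)
    (hcomp : ∃ e : A ≌ ActionSystems.Pt B, Nonempty (e.functor ≅ S.realization)) :
    Nonempty (ActionSystems.WStar S ≌ ActionSystems.Gpd B) := by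
  open ActionSystems in
  obtain ⟨e, ⟨i⟩⟩ := hcomp
  have : S.realization.IsEquivalence := Functor.isEquivalence_of_iso i
  have := Gpd.full_toRGraph S
  refine nonempty_equivalence_of_essImage_eq ((Whitehead.IsStar (S := S)).ι ⋙ Whitehead.toRGraph S)
    (Gpd.toRGraph B) ?_
  ext Γ
  constructor
  · rintro ⟨⟨W, hW⟩, ⟨a⟩⟩
    obtain ⟨X, hX, a₁, a₀, h₁, h₀, hs⟩ := hW.exists_groupoid hcons
    exact ⟨⟨X, hX⟩, ⟨RGraph.isoMk (X := (Gpd.toRGraph B).obj ⟨X, hX⟩)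
      (Y := (Whitehead.toRGraph S).obj W) a₁ a₀ h₁ hs h₀ ≪≫ a⟩⟩
  · rintro ⟨⟨X, hX⟩, ⟨a⟩⟩
    obtain ⟨W, hW, θ, b, h₁, h₀, hs⟩ :=
      Whitehead.exists_isStar_of_tower (S := S) (hX.hasInverses S)
    exact ⟨⟨W, hW⟩, ⟨RGraph.isoMk (X := (Whitehead.toRGraph S).obj W)
      (Y := (Gpd.toRGraph B).obj ⟨X, hX⟩) θ b h₁ hs h₀ ≪≫ a⟩⟩
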